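/- **Theorem 1 (deterministic approximate counting).** Graphs are finite, undirected and not necessarily simple: parallel edges and loops are allowed, and a loop contributes $2$ to the degree of its vertex. An orientation gives each edge one of its two directions (so a graph with $m$ edges has $2^m$ orientations, and a loop leaves its vertex in either direction); it is *sink-free* if every vertex has at least one outgoing edge. For a graph $G$ let $n$ and $m$ be its numbers of vertices and edges, and let $Z(G)$ be the number of sink-free orientations of $G$. There is a deterministic algorithm that, given a graph $G$ of minimum degree at least $3$, stored as an adjacency list (each vertex has an array with one entry (neighbour, edge label) per incident edge-end, in arbitrary order), and a rational number $\varepsilon=a/b$ with $0<\varepsilon<1$, given by natural numbers $a,b$, outputs a number $\widetilde Z$ with $$1-\varepsilon\le \frac{\widetilde Z}{Z(G)}\le 1+\varepsilon ,$$ and whose running time is $$O\!\left(\frac{n^{73}}{\varepsilon^{72}}\,\log\frac{n}{\varepsilon}\right)\qquad (n\ge 2),$$ where the implied constant is absolute; in particular it does not depend on $m$. Here the algorithm is a program of a random access machine with unit-cost instructions (constants, addition, truncated subtraction, multiplication, integer division, indirect load and store, jumps) on words of $O(\log(n+m+a+b))$ bits, and $\widetilde Z$ is output in binary floating point, as three words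 $M,E,F$ with $\widetilde Z=M\cdot 2^{E}/2^{F}$. -/

import Mathlib

/-! ### Multigraphs and sink-free orientations -/

/-- A finite undirected multigraph with vertices `0, …, n - 1` and edges `0, …, m - 1`.
Parallel edges and loops are allowed. The order in which the two endpoints of an edge are named
carries no meaning: it only serves as the reference with respect to which an orientation is
recorded. -/
structure MultiGraph (n m : ℕ) where
  endpoint : Fin m → Bool → Fin n

namespace MultiGraph

variable {n m : ℕ} (G : MultiGraph n m)

/-- The edge-ends located at the vertex `v`; a loop at `v` has both of its ends there. -/
def endsAt (v : Fin n) : Finset (Fin m × Bool) :=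
  Finset.univ.filter fun d => G.endpoint d.1 d.2 = v

/-- The degree of a vertex (a loop counts twice). -/
def degree (v : Fin n) : ℕ := (G.endsAt v).card

/-- An orientation chooses, for every edge, which of its two ends is the tail. In particular there
are `2 ^ m` orientations, and both directions of a loop at `v` leave `v`. -/
abbrev Orientation (_G : MultiGraph n m) : Type := Fin m → Bool

/-- The vertex `v` is a sink if no edge leaves it. -/
def IsSink (σ : G.Orientation) (v : Fin n) : Prop :=
  ∀ e : Fin m, G.endpoint e (σ e) ≠ v

instance (σ : G.Orientation) (v : Fin n) : Decidable (G.IsSink σ v) :=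
  inferInstanceAs (Decidable (∀ _, _))

/-- The number of sink-free orientations. -/
def numSFO : ℕ :=
  (Finset.univ.filter fun σ : G.Orientation => ∀ v, ¬ G.IsSink σ v).card

/-- An adjacency list of `G`: for every vertex `v`, a list, in arbitrary order, with one entry
`(neighbour, edge)` for each edge-end at `v`. -/
structure AdjList where
  list : Fin n → List (Fin n × Fin m)
  spec : ∀ v, (list v : Multiset (Fin n × Fin m)) =
    (G.endsAt v).val.map fun d => (G.endpoint d.1 (!d.2), d.1)

variable {G}

/-- The memory address at which the adjacency list of the vertex `i` starts (and that of the vertex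
`i - 1` ends). -/
def AdjList.offset (L : G.AdjList) (i : ℕ) : ℕ :=
  n + 5 + 2 * ∑ v : Fin n with v.val < i, (L.list v).length

/-- The input as a sequence of words: `n`, `m`, the numerator `a` and the denominator `b` of the
accuracy, the `n + 1` offsets, and the concatenated adjacency lists, two words per entry. -/
def AdjList.encode (L : G.AdjList) (a b : ℕ) : List ℕ :=
  [n, m, a, b] ++ (List.range (n + 1)).map L.offset ++
    (List.finRange n).flatMap fun v => (L.list v).flatMap fun p => [p.1.val, p.2.val]

end MultiGraph

/-! ### A random access machine -/

namespace RAM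

/-- Instructions. Arguments called `d`, `x`, `y` are register numbers; `k` is a constant and `l` a
position in the program. -/
inductive Instr : Type
  | const (d k : ℕ)
  | add (d x y : ℕ)
  | sub (d x y : ℕ)
  | mul (d x y : ℕ)
  | div (d x y : ℕ)
  | load (d x : ℕ)
  | store (x y : ℕ)
  | jump (l : ℕ)
  | jlt (x y l : ℕ)
  | halt

/-- A program is a finite list of instructions. -/
abbrev Program : Type := List Instr

/-- A configuration: program counter, registers, memory. -/
structure Config where
  pc : ℕ
  reg : ℕ → ℕ
  mem : ℕ → ℕ

/-- Put the value `z` into the register `d` and go to the next instruction. -/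
def Config.set (c : Config) (d z : ℕ) : Config :=
  { pc := c.pc + 1, reg := Function.update c.reg d z, mem := c.mem }

/-- The effect of one instruction. Subtraction is truncated at zero, division is rounded down (with
quotient zero if the divisor is zero), `load` and `store` use the contents of the register `x` as
the memory address, and `jlt` jumps if the contents of `x` are less than those of `y`. -/
def Instr.exec : Instr → Config → Config
  | .const d k, c => c.set d k
  | .add d x y, c => c.set d (c.reg x + c.reg y)
  | .sub d x y, c => c.set d (c.reg x - c.reg y)
  | .mul d x y, c => c.set d (c.reg x * c.reg y)
  | .div d x y, c => c.set d (c.reg x / c.reg y)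
  | .load d x, c => c.set d (c.mem (c.reg x))
  | .store x y, c => { c with pc := c.pc + 1, mem := Function.update c.mem (c.reg x) (c.reg y) }
  | .jump l, c => { c with pc := l }
  | .jlt x y l, c => { c with pc := if c.reg x < c.reg y then l else c.pc + 1 }
  | .halt, c => c

/-- The instruction about to be executed; outside the program this is `halt`. -/
def current (P : Program) (c : Config) : Instr := P.getD c.pc .halt

/-- One step of the program `P`. -/
def step (P : Program) (c : Config) : Config := (current P c).exec c

/-- The machine has stopped. -/
def Halted (P : Program) (c : Config) : Prop := current P c = .halt

/-- The initial configuration: the input is in the memory from address zero on, everything else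
is zero. -/
def init (input : List ℕ) : Config :=
  { pc := 0, reg := fun _ => 0, mem := fun i => input.getD i 0 }

/-- The configuration of `P` on the given input after `s` steps. -/
def run (P : Program) (input : List ℕ) (s : ℕ) : Config := (step P)^[s] (init input)

/-- All numbers held by the registers and the memory during the first `t` steps are less than `B`,
i.e. words of `⌈log₂ B⌉` bits suffice. -/
def FitsInWords (P : Program) (input : List ℕ) (t B : ℕ) : Prop :=
  ∀ s ≤ t, ∀ i, (run P input s).reg i < B ∧ (run P input s).mem i < B

/-- The number `M * 2 ^ E / 2 ^ F` represented by the output registers `M`, `E`, `F`, which are the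
registers 0, 1, 2 (binary floating point). -/
noncomputable def Config.output (c : Config) : ℝ :=
  (c.reg 0 : ℝ) * 2 ^ c.reg 1 / 2 ^ c.reg 2

end RAM

/-!
For `S` a set of vertices let `avoid S` be the number of orientations without sinks in `S`. The
number of sink-free orientations is `2 ^ m` times the product of the ratios
`avoid (insert v S) / avoid S`, one for each vertex, so these have to be approximated. If `v` is a
sink, then all its edges are prescribed and its neighbours are not sinks; hence the ratio is
`1 - avoid (S \ N(v)) / (2 ^ d * avoid S)`, where `d` is the degree of `v` (for a vertex with a loop
it is `1`). Removing the neighbours from `S` one at a time expresses the last quotient by ratios of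
the same kind.

All ratios lie in `[3 / 4, 1]`, and one level of this recursion multiplies their error by at most
`(15 / 16) ^ (d - 2)`. So the recursion may be stopped when a budget `k`, of which a vertex of
degree `d` consumes `d - 2`, is used up: the error is then of order `(15 / 16) ^ k`, while the
recursion tree has only `4 ^ k` nodes, independently of the number of edges. A budget
`k ≈ 11 * log₂ (n / ε)` makes the error at each vertex at most `ε / n` up to a constant and the
number of nodes of order `(n / ε) ^ 22`. The computation is done in fixed-point arithmetic, and the
recursion runs on an explicit stack in the memory of the machine.
-/

/-! ### Orientations that avoid sinks in a set -/

theorem card_pow_mul_card_filter_eqOn {ι α : Type*} [Fintype ι] [DecidableEq ι] [Fintype α]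
    [DecidableEq α] {p : (ι → α) → Prop} [DecidablePred p] {E : Finset ι}
    (hp : DependsOn p (E : Set ι)ᶜ) (τ : ι → α) :
    Fintype.card α ^ E.card * (Finset.univ.filter fun σ => p σ ∧ ∀ e ∈ E, σ e = τ e).card =
      (Finset.univ.filter p).card := by
  have hagree : ∀ {σ σ' : ι → α}, (∀ e ∉ E, σ e = σ' e) → p σ → p σ' := fun h hσ =>
    (hp fun e he => h e (by simpa using he)) ▸ hσ
  rw [← Fintype.card_coe E, ← Fintype.card_fun, ← Finset.card_univ, ← Finset.card_product]
  refine Finset.card_bij' (fun x _ e => if h : e ∈ E then x.1 ⟨e, h⟩ else x.2 e)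
    (fun σ _ => (fun e => σ e, E.piecewise τ σ)) ?_ ?_ ?_ ?_
  · rintro ⟨ρ, σ⟩ hσ
    simp only [Finset.mem_product, Finset.mem_filter, Finset.mem_univ, true_and] at hσ ⊢
    exact hagree (fun e he => by simp [he]) hσ.1
  · intro σ hσ
    simp only [Finset.mem_product, Finset.mem_filter, Finset.mem_univ, true_and] at hσ ⊢
    exact ⟨hagree (fun e he => by simp [he]) hσ, fun e he => by simp [he]⟩
  · rintro ⟨ρ, σ⟩ hσ
    simp only [Finset.mem_product, Finset.mem_filter, Finset.mem_univ, true_and] at hσ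
    ext e
    · simp
    · by_cases he : e ∈ E <;> simp [he, hσ.2]
  · intro σ _
    ext e
    by_cases he : e ∈ E <;> simp [he]

namespace MultiGraph

variable {n m : ℕ} (G : MultiGraph n m)

/-- The number of orientations for which no vertex of `S` is a sink. -/
def avoid (S : Finset (Fin n)) : ℕ :=
  (Finset.univ.filter fun σ : G.Orientation => ∀ v ∈ S, ¬ G.IsSink σ v).card

/-- The neighbours of a vertex; a vertex with a loop is its own neighbour. -/
def nbrs (v : Fin n) : Finset (Fin n) :=
  (G.endsAt v).image fun d => G.endpoint d.1 (!d.2)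

/-- The edges with at least one end at a vertex. -/
def edgesAt (v : Fin n) : Finset (Fin m) := (G.endsAt v).image Prod.fst

theorem mem_endsAt {v : Fin n} {e : Fin m} {b : Bool} :
    (e, b) ∈ G.endsAt v ↔ G.endpoint e b = v := by
  simp [endsAt]

theorem mem_nbrs {u v : Fin n} :
    u ∈ G.nbrs v ↔ ∃ e b, G.endpoint e b = v ∧ G.endpoint e (!b) = u := by
  simp [nbrs, mem_endsAt]

theorem mem_edgesAt {v : Fin n} {e : Fin m} :
    e ∈ G.edgesAt v ↔ ∃ b, G.endpoint e b = v := by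
  simp only [edgesAt, Finset.mem_image, Prod.exists, exists_and_right, exists_eq_right,
    G.mem_endsAt]

theorem mem_nbrs_comm {u v : Fin n} : u ∈ G.nbrs v ↔ v ∈ G.nbrs u := by
  rw [mem_nbrs, mem_nbrs]
  constructor <;> rintro ⟨e, b, h, h'⟩ <;> exact ⟨e, !b, h', by simpa using h⟩

theorem card_nbrs_le (v : Fin n) : (G.nbrs v).card ≤ G.degree v := Finset.card_image_le

theorem not_isSink_of_isSink_of_mem_nbrs {u v : Fin n} (hu : u ∈ G.nbrs v) {σ : G.Orientation}
    (hs : G.IsSink σ v) : ¬ G.IsSink σ u := by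
  obtain ⟨e, b, h, h'⟩ := G.mem_nbrs.1 hu
  intro hs'
  rcases Bool.eq_or_eq_not (σ e) b with hb | hb
  · exact hs e (hb ▸ h)
  · exact hs' e (hb ▸ h')

theorem not_isSink_of_loop {v : Fin n} (hv : v ∈ G.nbrs v) (σ : G.Orientation) :
    ¬ G.IsSink σ v :=
  fun hs => G.not_isSink_of_isSink_of_mem_nbrs hv hs hs

theorem avoid_empty : G.avoid ∅ = 2 ^ m := by
  simp [avoid, Orientation]

theorem avoid_univ : G.avoid Finset.univ = G.numSFO := by
  simp [avoid, numSFO]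

theorem avoid_insert_of_loop {v : Fin n} (hv : v ∈ G.nbrs v) (S : Finset (Fin n)) :
    G.avoid (insert v S) = G.avoid S := by
  simp [avoid, G.not_isSink_of_loop hv]

theorem endpoint_injective_of_loopless {v : Fin n} (hv : v ∉ G.nbrs v) {e : Fin m} {b c : Bool}
    (hb : G.endpoint e b = v) (hc : G.endpoint e c = v) : b = c := by
  by_contra hne
  exact hv (G.mem_nbrs.2 ⟨e, b, hb, by rwa [← Bool.eq_not_of_ne (Ne.symm hne)]⟩)

theorem card_edgesAt_of_loopless {v : Fin n} (hv : v ∉ G.nbrs v) :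
    (G.edgesAt v).card = G.degree v := by
  refine Finset.card_image_of_injOn ?_
  rintro ⟨e, b⟩ hb ⟨_, c⟩ hc rfl
  rw [G.endpoint_injective_of_loopless hv (G.mem_endsAt.1 hb) (G.mem_endsAt.1 hc)]

theorem isSink_iff_of_loopless {v : Fin n} (hv : v ∉ G.nbrs v) (σ : G.Orientation) :
    G.IsSink σ v ↔ ∀ e ∈ G.edgesAt v, σ e = decide (G.endpoint e true ≠ v) := by
  refine ⟨fun hs e he => ?_, fun h e he => ?_⟩
  · obtain ⟨b, hb⟩ := G.mem_edgesAt.1 he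
    have hσ := hs e
    cases b <;> cases hσe : σ e <;> simp_all
  · have hσ := h e (G.mem_edgesAt.2 ⟨_, he⟩)
    by_cases ht : G.endpoint e true = v
    · simp [ht, G.endpoint_injective_of_loopless hv he ht] at hσ
    · simp only [ht, ne_eq, not_false_eq_true, decide_true] at hσ
      exact ht (hσ ▸ he)

theorem dependsOn_not_isSink {v : Fin n} {T : Finset (Fin n)} (hvT : v ∉ T)
    (hT : Disjoint T (G.nbrs v)) :
    DependsOn (fun σ : G.Orientation => ∀ u ∈ T, ¬ G.IsSink σ u)
      (G.edgesAt v : Set (Fin m))ᶜ := by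
  intro σ σ' h
  refine propext (forall₂_congr fun u hu => not_congr (forall_congr' fun e => ?_))
  by_cases he : e ∈ G.edgesAt v
  · obtain ⟨b, hb⟩ := G.mem_edgesAt.1 he
    have hne : ∀ c, G.endpoint e c ≠ u := by
      rintro c rfl
      rcases Bool.eq_or_eq_not c b with rfl | rfl
      · exact hvT (hb ▸ hu)
      · exact Finset.disjoint_left.1 hT hu (G.mem_nbrs.2 ⟨e, b, hb, rfl⟩)
    simp [hne]
  · rw [h e (by simpa using he)]

theorem two_pow_degree_mul_card_isSink {v : Fin n} (hv : v ∉ G.nbrs v) {T : Finset (Fin n)}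
    (hvT : v ∉ T) (hT : Disjoint T (G.nbrs v)) :
    2 ^ G.degree v * (Finset.univ.filter fun σ : G.Orientation =>
      (∀ u ∈ T, ¬ G.IsSink σ u) ∧ G.IsSink σ v).card = G.avoid T := by
  rw [avoid, ← G.card_edgesAt_of_loopless hv, ← Fintype.card_bool]
  convert card_pow_mul_card_filter_eqOn (G.dependsOn_not_isSink hvT hT)
    fun e => decide (G.endpoint e true ≠ v) using 5
  exact G.isSink_iff_of_loopless hv _

theorem avoid_sdiff_nbrs_isSink_iff {v : Fin n} {S : Finset (Fin n)} (σ : G.Orientation) :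
    ((∀ u ∈ S \ G.nbrs v, ¬ G.IsSink σ u) ∧ G.IsSink σ v) ↔
      (∀ u ∈ S, ¬ G.IsSink σ u) ∧ G.IsSink σ v := by
  refine and_congr_left fun hs => ⟨fun h u hu => ?_, fun h u hu => h u (Finset.mem_sdiff.1 hu).1⟩
  by_cases hun : u ∈ G.nbrs v
  · exact G.not_isSink_of_isSink_of_mem_nbrs hun hs
  · exact h u (Finset.mem_sdiff.2 ⟨hu, hun⟩)

/-- If `v` is a sink, then its neighbours are not, and the vertices of `S \ G.nbrs v` do not see the
edges at `v`, which are then all prescribed. -/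
theorem avoid_insert {v : Fin n} (hv : v ∉ G.nbrs v) {S : Finset (Fin n)} (hvS : v ∉ S) :
    (G.avoid (insert v S) : ℝ) = G.avoid S - G.avoid (S \ G.nbrs v) / 2 ^ G.degree v := by
  have hsink := G.two_pow_degree_mul_card_isSink hv (T := S \ G.nbrs v) (by simp [hvS])
    Finset.sdiff_disjoint
  have hsplit := Finset.card_filter_add_card_filter_not
    (s := Finset.univ.filter fun σ : G.Orientation => ∀ u ∈ S, ¬ G.IsSink σ u)
    (fun σ => G.IsSink σ v)
  simp only [Finset.filter_filter] at hsplit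
  simp only [avoid_sdiff_nbrs_isSink_iff] at hsink
  have havoid : (Finset.univ.filter fun σ : G.Orientation =>
      (∀ u ∈ S, ¬ G.IsSink σ u) ∧ ¬ G.IsSink σ v).card = G.avoid (insert v S) := by
    simp [avoid, and_comm]
  rw [havoid, ← avoid] at hsplit
  rw [← hsink, ← hsplit]
  push_cast
  field_simp
  ring

end MultiGraph

theorem apply_sdiff_le_pow_mul {α : Type*} [DecidableEq α] {f : Finset α → ℝ} {c : ℝ} (hc : 0 ≤ c)
    {S T : Finset α} (h : ∀ R ⊆ S, ∀ u ∈ R, u ∈ T → f (R.erase u) ≤ c * f R) :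
    f (S \ T) ≤ c ^ (S ∩ T).card * f S := by
  induction T using Finset.induction_on with
  | empty => simp
  | insert u T hu ih =>
    have hT := ih fun R hR w hw hwT => h R hR w hw (Finset.mem_insert_of_mem hwT)
    by_cases huS : u ∈ S
    · have huST : u ∈ S \ T := Finset.mem_sdiff.2 ⟨huS, hu⟩
      rw [Finset.sdiff_insert, Finset.inter_insert_of_mem huS,
        Finset.card_insert_of_notMem (by simp [hu]), pow_succ', mul_assoc]
      exact (h _ Finset.sdiff_subset u huST (Finset.mem_insert_self u T)).trans
        (mul_le_mul_of_nonneg_left hT hc)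
    · rwa [Finset.sdiff_insert_of_notMem huS, Finset.inter_insert_of_notMem huS]

namespace MultiGraph

variable {n m : ℕ} (G : MultiGraph n m)

theorem mul_avoid_le_avoid_insert {S : Finset (Fin n)} {v : Fin n} (hvS : v ∉ S)
    (h : ∀ R ⊆ S, ∀ u ∈ R, u ∈ G.nbrs v → (G.avoid (R.erase u) : ℝ) ≤ 5 / 4 * G.avoid R)
    {c : ℕ} (hc : (S ∩ G.nbrs v).card ≤ c) :
    (1 - (5 / 4) ^ c / 2 ^ G.degree v : ℝ) * G.avoid S ≤ G.avoid (insert v S) := by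
  rw [sub_mul, one_mul]
  by_cases hloop : v ∈ G.nbrs v
  · rw [G.avoid_insert_of_loop hloop]
    exact sub_le_self _ (by positivity)
  · rw [G.avoid_insert hloop hvS, div_mul_eq_mul_div]
    gcongr
    calc (G.avoid (S \ G.nbrs v) : ℝ) ≤ (5 / 4) ^ (S ∩ G.nbrs v).card * G.avoid S :=
          apply_sdiff_le_pow_mul (f := fun S => (G.avoid S : ℝ)) (by norm_num) h
      _ ≤ (5 / 4) ^ c * G.avoid S := by gcongr; norm_num

/-- The probability that `v` is not a sink, given that no vertex of `S` is one. -/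
noncomputable def ratio (S : Finset (Fin n)) (v : Fin n) : ℝ :=
  G.avoid (insert v S) / G.avoid S

theorem ratio_le_one (S : Finset (Fin n)) (v : Fin n) : G.ratio S v ≤ 1 := by
  refine div_le_one_of_le₀ ?_ (Nat.cast_nonneg _)
  rw [Nat.cast_le]
  exact Finset.card_le_card (Finset.monotone_filter_right _ fun σ _ h u hu =>
    h u (Finset.mem_insert_of_mem hu))

theorem five_eighths_pow_le {k d : ℕ} (h : k ≤ d) : (5 / 8 : ℝ) ^ d ≤ (5 / 8) ^ k :=
  pow_le_pow_of_le_one (by norm_num) (by norm_num) h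

variable {G} (hdeg : ∀ v, 3 ≤ G.degree v)
include hdeg

theorem four_fifths_mul_avoid_le {S : Finset (Fin n)} {v w : Fin n} (hvS : v ∉ S)
    (hw : w ∈ G.nbrs v) (hwS : w ∉ S) :
    (4 / 5 : ℝ) * G.avoid S ≤ G.avoid (insert v S) := by
  induction hs : S.card using Nat.strong_induction_on generalizing S v w with
  | _ s ih =>
    have herase : ∀ R ⊆ S, ∀ u ∈ R, u ∈ G.nbrs v →
        (G.avoid (R.erase u) : ℝ) ≤ 5 / 4 * G.avoid R := by
      intro R hR u hu huv
      have hcard := (Finset.card_erase_lt_of_mem hu).trans_le (Finset.card_le_card hR)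
      have := ih _ (hs ▸ hcard) (Finset.notMem_erase u R) (G.mem_nbrs_comm.1 huv)
        (fun hv => hvS (hR (Finset.mem_of_mem_erase hv))) rfl
      rw [Finset.insert_erase hu] at this
      linarith
    have hlt : (S ∩ G.nbrs v).card < G.degree v :=
      (Finset.card_lt_card ⟨Finset.inter_subset_right, fun h =>
        hwS (Finset.mem_inter.1 (h hw)).1⟩).trans_le (G.card_nbrs_le v)
    obtain ⟨d, hd⟩ : ∃ d, G.degree v = d + 1 := ⟨G.degree v - 1, by omega⟩
    have hc : (5 / 4 : ℝ) ^ d / 2 ^ (d + 1) ≤ 1 / 5 := by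
      have hd2 := five_eighths_pow_le (k := 2) (d := d) (by have := hdeg v; omega)
      calc (5 / 4 : ℝ) ^ d / 2 ^ (d + 1) = (5 / 8) ^ d / 2 := by
            rw [pow_succ, ← div_div, ← div_pow]; norm_num
        _ ≤ 1 / 5 := by linarith
    refine le_trans ?_ (G.mul_avoid_le_avoid_insert hvS herase (c := d) (by omega))
    rw [hd]
    gcongr
    linarith

theorem avoid_erase_le {S : Finset (Fin n)} {u v : Fin n} (hu : u ∈ S) (huv : u ∈ G.nbrs v)
    (hvS : v ∉ S) : (G.avoid (S.erase u) : ℝ) ≤ 5 / 4 * G.avoid S := by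
  have := four_fifths_mul_avoid_le hdeg (Finset.notMem_erase u S) (G.mem_nbrs_comm.1 huv)
    (fun hv => hvS (Finset.mem_of_mem_erase hv))
  rw [Finset.insert_erase hu] at this
  linarith

theorem one_sub_pow_mul_avoid_le {S : Finset (Fin n)} {v : Fin n} (hvS : v ∉ S) :
    (1 - (5 / 8) ^ G.degree v : ℝ) * G.avoid S ≤ G.avoid (insert v S) := by
  have h := G.mul_avoid_le_avoid_insert hvS (fun R hR u hu huv =>
    avoid_erase_le hdeg hu huv fun hv => hvS (hR hv))
    ((Finset.card_le_card Finset.inter_subset_right).trans (G.card_nbrs_le v))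
  rwa [← div_pow, show (5 / 4 / 2 : ℝ) = 5 / 8 by norm_num] at h

theorem avoid_pos (S : Finset (Fin n)) : (0 : ℝ) < G.avoid S := by
  induction S using Finset.induction_on with
  | empty => simp [avoid_empty]
  | insert v S hv ih =>
    refine lt_of_lt_of_le (mul_pos (sub_pos.2 ?_) ih) (one_sub_pow_mul_avoid_le hdeg hv)
    exact pow_lt_one₀ (by norm_num) (by norm_num) (by have := hdeg v; omega)

theorem avoid_insert_eq (S : Finset (Fin n)) (v : Fin n) :
    (G.avoid (insert v S) : ℝ) = G.ratio S v * G.avoid S := by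
  rw [ratio, div_mul_cancel₀ _ (avoid_pos hdeg S).ne']

theorem one_sub_pow_le_ratio {S : Finset (Fin n)} {v : Fin n} (hv : v ∉ S) :
    1 - (5 / 8) ^ G.degree v ≤ G.ratio S v := by
  rw [ratio, le_div_iff₀ (avoid_pos hdeg S)]
  exact one_sub_pow_mul_avoid_le hdeg hv

theorem three_quarters_le_ratio {S : Finset (Fin n)} {v : Fin n} (hv : v ∉ S) :
    3 / 4 ≤ G.ratio S v := by
  linarith [one_sub_pow_le_ratio hdeg hv, five_eighths_pow_le (hdeg v)]

theorem four_fifths_le_ratio {S : Finset (Fin n)} {v w : Fin n} (hv : v ∉ S) (hw : w ∈ G.nbrs v)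
    (hwS : w ∉ S) : 4 / 5 ≤ G.ratio S v := by
  rw [ratio, le_div_iff₀ (avoid_pos hdeg S)]
  exact four_fifths_mul_avoid_le hdeg hv hw hwS

theorem ratio_of_loop {S : Finset (Fin n)} {v : Fin n} (hv : v ∈ G.nbrs v) : G.ratio S v = 1 := by
  rw [ratio, G.avoid_insert_of_loop hv, div_self (avoid_pos hdeg S).ne']

theorem ratio_of_loopless {S : Finset (Fin n)} {v : Fin n} (hv : v ∉ G.nbrs v) (hvS : v ∉ S) :
    G.ratio S v = 1 - G.avoid (S \ G.nbrs v) / G.avoid S / 2 ^ G.degree v := by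
  have := (avoid_pos hdeg S).ne'
  rw [ratio, G.avoid_insert hv hvS]
  field_simp

end MultiGraph

/-! ### Approximating the conditional probabilities -/

namespace MultiGraph

section Recursion

variable {V : Type*} [DecidableEq V]

/-- The effect of one entry `u` of the adjacency list of `v` on the current value `y`: halve it and,
if `u` is still in `S`, divide it by the approximation `g` (scaled by `Q`) of the conditional
probability at `u`. A loop annihilates it. -/
def visit (g : Finset V → V → ℕ) (Q : ℕ) (v : V) (S : Finset V) (y : ℕ) (u : V) : ℕ :=
  if u ∈ S then y / 2 * Q / g (S.erase u) u else if u = v then 0 else y / 2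

/-- The effect of a list of entries, where each vertex is removed from `S` once it has been
visited. -/
def sweep (g : Finset V → V → ℕ) (Q : ℕ) (v : V) : List V → Finset V → ℕ → ℕ
  | [], _, y => y
  | u :: l, S, y => sweep g Q v l (S.erase u) (visit g Q v S y u)

/-- The approximation of `Q` times the conditional probability that `v` is not a sink, given that
no vertex of `S` is one; the effort is limited by the budget `k`, of which a vertex of degree `d`
consumes `d - 2`. -/
def approx (adj : V → List V) (Q k : ℕ) (S : Finset V) (v : V) : ℕ :=
  if _h : k + 2 ≤ (adj v).length ∨ (adj v).length < 3 then Q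
  else Q - sweep (approx adj Q (k + 2 - (adj v).length)) Q v (adj v) S Q
termination_by k

theorem approx_le (adj : V → List V) (Q k : ℕ) (S : Finset V) (v : V) : approx adj Q k S v ≤ Q := by
  rw [approx]
  split_ifs
  exacts [le_rfl, Nat.sub_le _ _]

theorem sweep_zero (g : Finset V → V → ℕ) (Q : ℕ) (v : V) (l : List V) (S : Finset V) :
    sweep g Q v l S 0 = 0 := by
  induction l generalizing S with
  | nil => rfl
  | cons u l ih => simp [sweep, visit, ih]

theorem sweep_of_loop (g : Finset V → V → ℕ) (Q : ℕ) {v : V} {l : List V} (hl : v ∈ l)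
    {S : Finset V} (hv : v ∉ S) (y : ℕ) : sweep g Q v l S y = 0 := by
  induction l generalizing S y with
  | nil => simp at hl
  | cons u l ih =>
    rcases List.mem_cons.1 hl with rfl | hl
    · simp [sweep, visit, hv, sweep_zero]
    · exact ih hl (fun h => hv (Finset.mem_of_mem_erase h)) _

end Recursion

variable {n m : ℕ} {G : MultiGraph n m}

/-- The list of the neighbours of a vertex, with multiplicities. -/
def AdjList.neighbors (L : G.AdjList) (v : Fin n) : List (Fin n) := (L.list v).map Prod.fst

theorem AdjList.length_list (L : G.AdjList) (v : Fin n) : (L.list v).length = G.degree v := by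
  simpa [degree] using congrArg Multiset.card (L.spec v)

theorem AdjList.length_neighbors (L : G.AdjList) (v : Fin n) :
    (L.neighbors v).length = G.degree v := by
  rw [neighbors, List.length_map, L.length_list]

theorem AdjList.mem_neighbors (L : G.AdjList) {u v : Fin n} :
    u ∈ L.neighbors v ↔ u ∈ G.nbrs v := by
  have h : (L.neighbors v : Multiset (Fin n)) =
      (G.endsAt v).val.map fun d => G.endpoint d.1 (!d.2) := by
    rw [neighbors, ← Multiset.map_coe, L.spec, Multiset.map_map]
    rfl
  rw [← Multiset.mem_coe, h, Multiset.mem_map, nbrs, Finset.mem_image]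
  rfl

theorem AdjList.toFinset_neighbors (L : G.AdjList) (v : Fin n) :
    (L.neighbors v).toFinset = G.nbrs v := by
  ext u
  rw [List.mem_toFinset, L.mem_neighbors]

/-! ### Lower bounds for the approximations -/

/-- The approximations `g`, scaled by `Q`, respect the bound `four_fifths_le_ratio` at the
neighbours of `v`. -/
def LowerBound (G : MultiGraph n m) (g : Finset (Fin n) → Fin n → ℕ) (Q : ℕ) (v : Fin n) : Prop :=
  ∀ S, ∀ u ∈ G.nbrs v, u ∉ S → v ∉ S → (4 / 5 : ℝ) * Q ≤ g S u

theorem cast_half_le (y : ℕ) : ((y / 2 : ℕ) : ℝ) ≤ y / 2 :=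
  mod_cast Nat.cast_div_le (α := ℝ) (m := y) (n := 2)

theorem cast_half_mul_div_le {Q x : ℕ} (hx : (4 / 5 : ℝ) * Q ≤ x) (y : ℕ) :
    ((y / 2 * Q / x : ℕ) : ℝ) ≤ 5 / 8 * y := by
  rcases Nat.eq_zero_or_pos Q with rfl | hQ
  · simp
  have hQ' : (0 : ℝ) < Q := mod_cast hQ
  refine Nat.cast_div_le.trans ((div_le_iff₀ (by linarith)).2 ?_)
  calc ((y / 2 * Q : ℕ) : ℝ) = (y / 2 : ℕ) * Q := Nat.cast_mul _ _
    _ ≤ y / 2 * Q := by gcongr; exact cast_half_le y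
    _ = 5 / 8 * y * (4 / 5 * Q) := by ring
    _ ≤ 5 / 8 * y * x := by gcongr

section

variable {g : Finset (Fin n) → Fin n → ℕ} {Q : ℕ} {v : Fin n}

theorem visit_le_half {S : Finset (Fin n)} {u : Fin n} (hu : u ∉ S) (y : ℕ) :
    (visit g Q v S y u : ℝ) ≤ y / 2 := by
  rw [visit, if_neg hu]
  split_ifs
  · simp only [Nat.cast_zero]; positivity
  · exact cast_half_le y

theorem visit_le (hg : LowerBound G g Q v) {S : Finset (Fin n)} (hv : v ∉ S) {u : Fin n}
    (hu : u ∈ G.nbrs v) (y : ℕ) : (visit g Q v S y u : ℝ) ≤ 5 / 8 * y := by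
  by_cases huS : u ∈ S
  · rw [visit, if_pos huS]
    exact cast_half_mul_div_le
      (hg _ u hu (Finset.notMem_erase u S) fun h => hv (Finset.mem_of_mem_erase h)) y
  · linarith [visit_le_half (g := g) (Q := Q) (v := v) huS y, Nat.cast_nonneg (α := ℝ) y]

theorem sweep_le (hg : LowerBound G g Q v) {l : List (Fin n)} (hl : ∀ u ∈ l, u ∈ G.nbrs v)
    {S : Finset (Fin n)} (hv : v ∉ S) {w : Fin n} (hw : w ∉ S) (y : ℕ) :
    (sweep g Q v l S y : ℝ) ≤ (4 / 5) ^ l.count w * (5 / 8) ^ l.length * y := by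
  induction l generalizing S y with
  | nil => simp [sweep]
  | cons u l ih =>
    rw [List.forall_mem_cons] at hl
    have hrest := ih hl.2 (S := S.erase u) (fun h => hv (Finset.mem_of_mem_erase h))
      (fun h => hw (Finset.mem_of_mem_erase h)) (visit g Q v S y u)
    rw [sweep, List.length_cons, pow_succ]
    refine hrest.trans ?_
    rcases eq_or_ne u w with rfl | huw
    · rw [List.count_cons_self, pow_succ]
      calc _ ≤ (4 / 5 : ℝ) ^ l.count u * (5 / 8) ^ l.length * (y / 2) := by
            gcongr; exact visit_le_half hw y
        _ = _ := by ring
    · rw [List.count_cons_of_ne huw]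
      calc _ ≤ (4 / 5 : ℝ) ^ l.count w * (5 / 8) ^ l.length * (5 / 8 * y) := by
            gcongr; exact visit_le hg hv hl.1 y
        _ = _ := by ring

end

theorem sub_le_cast_sub (x y : ℕ) : (x : ℝ) - y ≤ ((x - y : ℕ) : ℝ) := by
  rw [sub_le_iff_le_add, ← Nat.cast_add, Nat.cast_le]
  exact le_tsub_add

section

variable (hdeg : ∀ v, 3 ≤ G.degree v) (L : G.AdjList) (Q k : ℕ)
include hdeg

theorem LowerBound.approx_ge {v : Fin n}
    (hg : ∀ j < k, LowerBound G (approx L.neighbors Q j) Q v) {S : Finset (Fin n)} (hv : v ∉ S)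
    {w : Fin n} (hw : w ∉ S) :
    (1 - (4 / 5) ^ (L.neighbors v).count w * (1 / 4) : ℝ) * Q ≤ approx L.neighbors Q k S v := by
  have hQ : (0 : ℝ) ≤ (4 / 5) ^ (L.neighbors v).count w * (1 / 4) * Q := by positivity
  rw [approx, L.length_neighbors]
  split_ifs with h
  · linarith
  · have hsweep := sweep_le (hg (k + 2 - G.degree v) (by omega))
      (fun u hu => L.mem_neighbors.1 hu) hv hw Q
    have hpow : (5 / 8 : ℝ) ^ G.degree v ≤ 1 / 4 := by
      linarith [five_eighths_pow_le (hdeg v)]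
    rw [L.length_neighbors] at hsweep
    calc (1 - (4 / 5) ^ (L.neighbors v).count w * (1 / 4) : ℝ) * Q
        = Q - (4 / 5) ^ (L.neighbors v).count w * (1 / 4) * Q := by ring
      _ ≤ Q - (4 / 5) ^ (L.neighbors v).count w * (5 / 8) ^ G.degree v * Q := by gcongr
      _ ≤ _ := (sub_le_sub_left hsweep _).trans (sub_le_cast_sub _ _)

theorem lowerBound_approx (v : Fin n) : LowerBound G (approx L.neighbors Q k) Q v := by
  induction k using Nat.strong_induction_on generalizing v with
  | _ k ih =>
    intro S u hu huS hvS
    have hcount : (4 / 5 : ℝ) ^ (L.neighbors u).count v ≤ 4 / 5 :=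
      pow_le_of_le_one (by norm_num) (by norm_num)
        (List.count_pos_iff.2 (L.mem_neighbors.2 (G.mem_nbrs_comm.1 hu))).ne'
    refine le_trans ?_ (LowerBound.approx_ge hdeg L Q k (fun j hj => ih j hj u) huS hvS)
    gcongr
    linarith

theorem three_quarters_le_approx {S : Finset (Fin n)} {v : Fin n} (hv : v ∉ S) :
    (3 / 4 : ℝ) * Q ≤ approx L.neighbors Q k S v := by
  have hcount : (4 / 5 : ℝ) ^ (L.neighbors v).count v ≤ 1 :=
    pow_le_one₀ (by norm_num) (by norm_num)
  refine le_trans ?_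
    (LowerBound.approx_ge hdeg L Q k (fun j _ => lowerBound_approx hdeg L Q j v) hv hv)
  gcongr
  linarith

end

end MultiGraph

/-! ### The error of the approximations -/

theorem sub_one_le_cast_div (x y : ℕ) : (x : ℝ) / y - 1 ≤ ((x / y : ℕ) : ℝ) := by
  rw [← Nat.floor_div_eq_div (K := ℝ)]
  exact (Nat.sub_one_lt_floor _).le

theorem abs_cast_half_div_sub_le {Q : ℕ} (hQ : 0 < Q) (y : ℕ) :
    |((y / 2 : ℕ) : ℝ) / Q - y / Q / 2| ≤ 1 / 2 / Q := by
  have hlo : (y : ℝ) / 2 - 1 / 2 ≤ ((y / 2 : ℕ) : ℝ) := by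
    have : (y : ℝ) ≤ 2 * ((y / 2 : ℕ) : ℝ) + 1 := mod_cast (by omega : y ≤ 2 * (y / 2) + 1)
    linarith
  rw [div_right_comm, ← sub_div, abs_div, Nat.abs_cast]
  gcongr
  rw [abs_sub_comm, abs_of_nonneg (sub_nonneg.2 (MultiGraph.cast_half_le y))]
  linarith

theorem abs_cast_half_mul_div_sub_le {Q x : ℕ} (hQ : 0 < Q) (hx : (4 / 5 : ℝ) * Q ≤ x) (y : ℕ) :
    |((y / 2 * Q / x : ℕ) : ℝ) / Q - y / Q / 2 / (x / Q)| ≤ 13 / 8 / Q := by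
  have hQ' : (0 : ℝ) < Q := mod_cast hQ
  have hx0 : (0 : ℝ) < x := by linarith
  have hQx : (Q : ℝ) / x ≤ 5 / 4 := by
    rw [div_le_iff₀ hx0]
    linarith
  have hhalf : |((y / 2 : ℕ) : ℝ) * Q / x - y * Q / 2 / x| ≤ 5 / 8 := by
    have hfactor : ((y / 2 : ℕ) : ℝ) * Q / x - y * Q / 2 / x =
        (((y / 2 : ℕ) : ℝ) / Q - y / Q / 2) * Q * (Q / x) := by
      field_simp
    rw [hfactor, abs_mul, abs_mul, Nat.abs_cast, abs_of_pos (by positivity : (Q : ℝ) / x > 0)]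
    calc _ ≤ 1 / 2 / (Q : ℝ) * Q * (5 / 4) := by
          gcongr; exact abs_cast_half_div_sub_le hQ y
      _ = 5 / 8 := by field_simp; norm_num
  have hfloor : |((y / 2 * Q / x : ℕ) : ℝ) - (y / 2 : ℕ) * Q / x| ≤ 1 := by
    have hup := Nat.cast_div_le (α := ℝ) (m := y / 2 * Q) (n := x)
    have hlo := sub_one_le_cast_div (y / 2 * Q) x
    rw [Nat.cast_mul] at hup hlo
    rw [abs_le]
    constructor <;> linarith
  have hdiv : (y : ℝ) / Q / 2 / (x / Q) = y * Q / 2 / x / Q := by field_simp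
  rw [hdiv, ← sub_div, abs_div, Nat.abs_cast]
  gcongr
  linarith [abs_sub_le ((y / 2 * Q / x : ℕ) : ℝ) ((y / 2 : ℕ) * Q / x) (y * Q / 2 / x)]

theorem abs_div_sub_div_le {y x r Y η : ℝ} (hx : 4 / 5 ≤ x) (hr : 4 / 5 ≤ r) (hY : 0 ≤ Y)
    (hxr : |x - r| ≤ η) :
    |y / 2 / x - Y / 2 / r| ≤ 5 / 8 * (|y - Y| + 5 / 4 * Y * η) := by
  have hx0 : 0 < x := by linarith
  have hr0 : 0 < r := by linarith
  have hfactor : y / 2 / x - Y / 2 / r = 1 / (2 * x) * ((y - Y) - Y / r * (x - r)) := by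
    field_simp
    ring
  have hinv : 1 / (2 * x) ≤ 5 / 8 := by
    rw [div_le_iff₀ (by linarith)]
    linarith
  have hYr : Y / r ≤ 5 / 4 * Y := by
    rw [div_le_iff₀ hr0]
    nlinarith
  rw [hfactor, abs_mul, abs_of_pos (by positivity)]
  gcongr
  refine (abs_sub _ _).trans ?_
  rw [abs_mul, abs_of_nonneg (by positivity : 0 ≤ Y / r)]
  gcongr

namespace MultiGraph

variable {n m : ℕ} {G : MultiGraph n m}

section

variable (hdeg : ∀ v, 3 ≤ G.degree v) {g : Finset (Fin n) → Fin n → ℕ} {Q : ℕ} (hQ : 0 < Q)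
  {v : Fin n} {η : ℝ} (hg : LowerBound G g Q v)
  (herr : ∀ S, ∀ u ∉ S, |(g S u : ℝ) / Q - G.ratio S u| ≤ η) {w : ℝ} (hw : 0 ≤ w)
include hdeg hQ hg herr hw

theorem abs_visit_sub_le {S : Finset (Fin n)} (hv : v ∉ S) {u : Fin n} (hu : u ∈ G.nbrs v)
    (huv : u ≠ v) (y : ℕ) :
    |(visit g Q v S y u : ℝ) / Q - w / 2 * G.avoid (S.erase u)| ≤
      5 / 8 * (|(y : ℝ) / Q - w * G.avoid S| + 5 / 4 * (w * G.avoid S) * η) + 13 / 8 / Q := by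
  have hQ' : (0 : ℝ) < Q := mod_cast hQ
  have hη : 0 ≤ η := (abs_nonneg _).trans (herr _ v hv)
  by_cases huS : u ∈ S
  · have hvS : v ∉ S.erase u := fun h => hv (Finset.mem_of_mem_erase h)
    have hu' := Finset.notMem_erase u S
    have hx := hg _ u hu hu' hvS
    have hr := four_fifths_le_ratio hdeg hu' (G.mem_nbrs_comm.1 hu) hvS
    have hratio : w / 2 * G.avoid (S.erase u) = w * G.avoid S / 2 / G.ratio (S.erase u) u := by
      have := avoid_insert_eq hdeg (S.erase u) u
      rw [Finset.insert_erase huS] at this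
      rw [this]
      field_simp
    rw [visit, if_pos huS, hratio]
    refine (abs_sub_le _ ((y : ℝ) / Q / 2 / (g (S.erase u) u / Q)) _).trans ?_
    rw [add_comm]
    exact add_le_add (abs_div_sub_div_le ((le_div_iff₀ hQ').2 hx) hr (by positivity)
      (herr _ u hu')) (abs_cast_half_mul_div_sub_le hQ hx y)
  · rw [visit, if_neg huS, if_neg huv, Finset.erase_eq_of_notMem huS]
    refine (abs_sub_le _ ((y : ℝ) / Q / 2) _).trans ?_
    have hhalf : (y : ℝ) / Q / 2 - w / 2 * G.avoid S = (y / Q - w * G.avoid S) / 2 := by ring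
    have hround : (1 / 2 / Q : ℝ) ≤ 13 / 8 / Q :=
      div_le_div_of_nonneg_right (by norm_num) hQ'.le
    have hnonneg : 0 ≤ 5 / 4 * (w * G.avoid S) * η := by positivity
    rw [hhalf, abs_div, abs_two]
    linarith [abs_cast_half_div_sub_le hQ y, abs_nonneg ((y : ℝ) / Q - w * G.avoid S)]

theorem abs_sweep_sub_le {l : List (Fin n)} (hl : ∀ u ∈ l, u ∈ G.nbrs v ∧ u ≠ v)
    {S : Finset (Fin n)} (hv : v ∉ S) (y : ℕ) :
    |(sweep g Q v l S y : ℝ) / Q - w * G.avoid (S \ l.toFinset) / 2 ^ l.length| ≤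
      (5 / 8) ^ l.length *
        (|(y : ℝ) / Q - w * G.avoid S| + l.length * (5 / 4 * (w * G.avoid S) * η)) +
      13 / 8 / Q * ∑ i ∈ Finset.range l.length, (5 / 8 : ℝ) ^ i := by
  have hη : 0 ≤ η := (abs_nonneg _).trans (herr _ v hv)
  induction l generalizing S y w with
  | nil => simp [sweep]
  | cons u l ih =>
    rw [List.forall_mem_cons] at hl
    obtain ⟨⟨hu, huv⟩, hl⟩ := hl
    have hvS : v ∉ S.erase u := fun h => hv (Finset.mem_of_mem_erase h)
    have hvisit := abs_visit_sub_le hdeg hQ hg herr hw hv hu huv y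
    have hideal : w * G.avoid (S \ (u :: l).toFinset) / 2 ^ (u :: l).length =
        w / 2 * G.avoid (S.erase u \ l.toFinset) / 2 ^ l.length := by
      rw [List.toFinset_cons, Finset.sdiff_insert, Finset.erase_sdiff_comm, List.length_cons,
        pow_succ]
      field_simp
    have hweight : w / 2 * G.avoid (S.erase u) ≤ 5 / 8 * (w * G.avoid S) := by
      have herase : (G.avoid (S.erase u) : ℝ) ≤ 5 / 4 * G.avoid S := by
        by_cases huS : u ∈ S
        · exact avoid_erase_le hdeg huS hu hv
        · rw [Finset.erase_eq_of_notMem huS]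
          linarith [avoid_pos hdeg S]
      linarith [mul_le_mul_of_nonneg_left herase hw]
    rw [hideal, sweep, List.length_cons, Finset.sum_range_succ, pow_succ]
    calc _ ≤ (5 / 8) ^ l.length * (_ + l.length * (5 / 4 * (w / 2 * G.avoid (S.erase u)) * η)) +
            13 / 8 / Q * ∑ i ∈ Finset.range l.length, (5 / 8 : ℝ) ^ i :=
          ih (by positivity) hl hvS (visit g Q v S y u)
      _ ≤ (5 / 8) ^ l.length * ((5 / 8 * (|(y : ℝ) / Q - w * G.avoid S| +
              5 / 4 * (w * G.avoid S) * η) + 13 / 8 / Q) +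
            l.length * (5 / 4 * (5 / 8 * (w * G.avoid S)) * η)) + _ := by gcongr
      _ = _ := by push_cast; ring

end

theorem weight_le_pow {d : ℕ} (hd : 3 ≤ d) :
    (5 / 8 : ℝ) ^ d * (d * (5 / 4)) ≤ (15 / 16) ^ (d - 2) := by
  obtain ⟨c, rfl⟩ : ∃ c, d = c + 3 := ⟨d - 3, by omega⟩
  rw [show c + 3 - 2 = c + 1 by omega]
  clear hd
  induction c with
  | zero => norm_num
  | succ c ih =>
    have hstep : (5 / 8 : ℝ) * (c + 1 + 3) ≤ 15 / 16 * (c + 3) := by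
      linarith [Nat.cast_nonneg (α := ℝ) c]
    push_cast at ih ⊢
    calc (5 / 8 : ℝ) ^ (c + 1 + 3) * ((c + 1 + 3) * (5 / 4))
        = (5 / 8) ^ (c + 3) * (5 / 4) * (5 / 8 * (c + 1 + 3)) := by ring
      _ ≤ (5 / 8) ^ (c + 3) * (5 / 4) * (15 / 16 * (c + 3)) := by gcongr
      _ = 15 / 16 * ((5 / 8) ^ (c + 3) * ((c + 3) * (5 / 4))) := by ring
      _ ≤ 15 / 16 * (15 / 16) ^ (c + 1) := by gcongr
      _ = (15 / 16) ^ (c + 1 + 1) := by ring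

theorem five_eighths_pow_le_of_three_le {d : ℕ} (hd : 3 ≤ d) :
    (5 / 8 : ℝ) ^ d ≤ (15 / 16) ^ (d - 2) := by
  have hd' : (3 : ℝ) ≤ d := mod_cast hd
  exact (le_mul_of_one_le_right (by positivity) (by linarith)).trans (weight_le_pow hd)

theorem sum_range_five_eighths_pow_le (d : ℕ) :
    ∑ i ∈ Finset.range d, (5 / 8 : ℝ) ^ i ≤ 8 / 3 := by
  rw [geom_sum_eq (by norm_num), div_le_iff_of_neg (by norm_num)]
  have : (0 : ℝ) < (5 / 8) ^ d := by positivity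
  linarith

variable (hdeg : ∀ v, 3 ≤ G.degree v) (L : G.AdjList) {Q : ℕ} (hQ : 0 < Q)
include hdeg hQ

theorem abs_sub_sweep_sub_ratio_le {k : ℕ} {η : ℝ}
    (herr : ∀ S, ∀ u ∉ S, |(approx L.neighbors Q k S u : ℝ) / Q - G.ratio S u| ≤ η)
    {S : Finset (Fin n)} {v : Fin n} (hv : v ∉ S) (hloop : v ∉ G.nbrs v) :
    |((Q - sweep (approx L.neighbors Q k) Q v (L.neighbors v) S Q : ℕ) : ℝ) / Q - G.ratio S v| ≤
      (15 / 16) ^ (G.degree v - 2) * η + 13 / 3 / Q := by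
  have hQ' : (0 : ℝ) < Q := mod_cast hQ
  have hη : 0 ≤ η := (abs_nonneg _).trans (herr _ v hv)
  have hS := avoid_pos hdeg S
  have hlow := lowerBound_approx hdeg L Q k v
  have hmem : ∀ u ∈ L.neighbors v, u ∈ G.nbrs v := fun u => L.mem_neighbors.1
  have hsweep : sweep (approx L.neighbors Q k) Q v (L.neighbors v) S Q ≤ Q := by
    have h := sweep_le hlow hmem hv hv Q
    rw [← Nat.cast_le (α := ℝ)]
    refine h.trans (mul_le_of_le_one_left hQ'.le (mul_le_one₀ ?_ (by positivity) ?_)) <;>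
      exact pow_le_one₀ (by norm_num) (by norm_num)
  have herror := abs_sweep_sub_le hdeg hQ hlow herr (inv_nonneg.2 hS.le)
    (fun u hu => ⟨hmem u hu, fun h => hloop (h ▸ hmem u hu)⟩) hv Q
  rw [L.toFinset_neighbors, L.length_neighbors, inv_mul_cancel₀ hS.ne', div_self hQ'.ne',
    sub_self, abs_zero, zero_add, mul_one, ← div_eq_inv_mul] at herror
  rw [Nat.cast_sub hsweep, sub_div, div_self hQ'.ne', ratio_of_loopless hdeg hloop hv,
    sub_sub_sub_cancel_left, abs_sub_comm]
  calc _ ≤ (5 / 8) ^ G.degree v * (G.degree v * (5 / 4)) * η +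
        13 / 8 / Q * ∑ i ∈ Finset.range (G.degree v), (5 / 8 : ℝ) ^ i := by
        rw [mul_assoc, mul_assoc]; exact herror
    _ ≤ (15 / 16) ^ (G.degree v - 2) * η + 13 / 8 / Q * (8 / 3) := by
        gcongr
        exacts [weight_le_pow (hdeg v), sum_range_five_eighths_pow_le _]
    _ = _ := by ring

theorem abs_approx_sub_ratio_le (k : ℕ) {S : Finset (Fin n)} {v : Fin n} (hv : v ∉ S) :
    |(approx L.neighbors Q k S v : ℝ) / Q - G.ratio S v| ≤ (15 / 16) ^ k + 70 / Q := by
  have hQ' : (0 : ℝ) < Q := mod_cast hQ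
  induction k using Nat.strong_induction_on generalizing S v with
  | _ k ih =>
    have hd := hdeg v
    rw [approx, L.length_neighbors]
    split_ifs with h
    · have hpow : (15 / 16 : ℝ) ^ (G.degree v - 2) ≤ (15 / 16) ^ k :=
        pow_le_pow_of_le_one (by norm_num) (by norm_num) (by omega)
      rw [div_self hQ'.ne', abs_of_nonneg (sub_nonneg.2 (G.ratio_le_one S v))]
      linarith [one_sub_pow_le_ratio hdeg hv, five_eighths_pow_le_of_three_le hd,
        (by positivity : (0 : ℝ) ≤ 70 / Q)]
    by_cases hloop : v ∈ G.nbrs v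
    · rw [sweep_of_loop _ _ (L.mem_neighbors.2 hloop) hv, tsub_zero, div_self hQ'.ne',
        ratio_of_loop hdeg hloop, sub_self, abs_zero]
      positivity
    · refine (abs_sub_sweep_sub_ratio_le hdeg L hQ
        (fun S u hu => ih (k + 2 - G.degree v) (by omega) hu) hv hloop).trans ?_
      have hsplit : (15 / 16 : ℝ) ^ k =
          (15 / 16) ^ (G.degree v - 2) * (15 / 16) ^ (k + 2 - G.degree v) := by
        rw [← pow_add]
        congr 1
        omega
      have hround : (15 / 16 : ℝ) ^ (G.degree v - 2) * (70 / Q) + 13 / 3 / Q ≤ 70 / Q := by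
        calc _ ≤ (15 / 16 : ℝ) ^ 1 * (70 / Q) + 13 / 3 / Q := by
              gcongr ?_ * _ + _
              exact pow_le_pow_of_le_one (by norm_num) (by norm_num) (by omega)
          _ = (1679 / 24) / Q := by ring
          _ ≤ 70 / Q := by gcongr; norm_num
      rw [hsplit]
      linarith

end MultiGraph

/-! ### Reasoning about programs of the random access machine -/

namespace RAM

/-- All words of the configuration are less than `B`. -/
def Fits (B : ℕ) (c : Config) : Prop := ∀ i, c.reg i < B ∧ c.mem i < B

/-- Started in `c` with words less than `B`, the program `P` reaches within `T` steps a
configuration with the property `Post`, and all words stay less than `B` on the way. The rules below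
are in continuation style: they reduce a claim on a configuration to one on its successor. -/
def Reaches (P : Program) (B : ℕ) (Post : Config → Prop) (T : ℕ) (c : Config) : Prop :=
  Fits B c → ∃ t ≤ T, Post ((step P)^[t] c) ∧ ∀ s ≤ t, Fits B ((step P)^[s] c)

/-- The registers with contents `l`, the remaining ones being zero. -/
def regs (l : List ℕ) : ℕ → ℕ := fun i => l.getD i 0

variable {P : Program} {B T pc d x y k p : ℕ} {Post : Config → Prop} {c : Config} {l : List ℕ}
  {μ : ℕ → ℕ}

theorem update_regs (h : d < l.length) (z : ℕ) :
    Function.update (regs l) d z = regs (l.set d z) := by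
  funext i
  rcases eq_or_ne i d with rfl | hi
  · simp [regs, h]
  · simp [regs, hi, List.getD, hi.symm]

theorem step_eq_exec {i : Instr} (hi : P.getD pc .halt = i) {r : ℕ → ℕ} :
    step P ⟨pc, r, μ⟩ = i.exec ⟨pc, r, μ⟩ := by
  rw [step, current, hi]

namespace Reaches

theorem done (h : Post c) : Reaches P B Post T c := fun hc =>
  ⟨0, Nat.zero_le _, h, fun s hs => by rwa [Nat.le_zero.1 hs]⟩

theorem mono {T' : ℕ} (h : Reaches P B Post T c) (hT : T ≤ T') : Reaches P B Post T' c := fun hc =>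
  have ⟨t, ht, h⟩ := h hc
  ⟨t, ht.trans hT, h⟩

theorem of_step (hf : Fits B c → Fits B (step P c)) (h : Reaches P B Post T (step P c)) :
    Reaches P B Post (T + 1) c := fun hc => by
  obtain ⟨t, ht, hpost, hfits⟩ := h (hf hc)
  refine ⟨t + 1, Nat.succ_le_succ ht, hpost, fun s hs => ?_⟩
  rcases s with _ | s
  · exact hc
  · exact hfits s (Nat.le_of_succ_le_succ hs)

theorem of_set {z : ℕ} (hd : d < l.length)
    (hstep : step P ⟨pc, regs l, μ⟩ = Config.set ⟨pc, regs l, μ⟩ d z)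
    (hz : Fits B ⟨pc, regs l, μ⟩ → z < B)
    (h : Reaches P B Post T ⟨pc + 1, regs (l.set d z), μ⟩) :
    Reaches P B Post (T + 1) ⟨pc, regs l, μ⟩ := by
  refine of_step (fun hc i => ⟨?_, ?_⟩) (by rwa [hstep, Config.set, update_regs hd])
  · rw [hstep]
    rcases eq_or_ne i d with rfl | hi
    · simpa [Config.set] using hz hc
    · simpa [Config.set, hi] using (hc i).1
  · rw [hstep]
    exact (hc i).2

theorem const (hi : P.getD pc .halt = .const d k) (hk : k < B)
    (h : Reaches P B Post T ⟨pc + 1, regs (l.set d k), μ⟩)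
    (hd : d < l.length := by exact Nat.le_of_ble_eq_true rfl) :
    Reaches P B Post (T + 1) ⟨pc, regs l, μ⟩ :=
  of_set hd (step_eq_exec hi) (fun _ => hk) h

theorem add (hi : P.getD pc .halt = .add d x y) (hxy : l.getD x 0 + l.getD y 0 < B)
    (h : Reaches P B Post T ⟨pc + 1, regs (l.set d (l.getD x 0 + l.getD y 0)), μ⟩)
    (hd : d < l.length := by exact Nat.le_of_ble_eq_true rfl) :
    Reaches P B Post (T + 1) ⟨pc, regs l, μ⟩ :=
  of_set hd (step_eq_exec hi) (fun _ => hxy) h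

theorem copy (hi : P.getD pc .halt = .add d x y) (hy : l.getD y 0 = 0)
    (h : Reaches P B Post T ⟨pc + 1, regs (l.set d (l.getD x 0)), μ⟩)
    (hd : d < l.length := by exact Nat.le_of_ble_eq_true rfl) :
    Reaches P B Post (T + 1) ⟨pc, regs l, μ⟩ := by
  refine of_set hd ((step_eq_exec hi).trans ?_) (fun hc => (hc x).1) h
  change Config.set _ d (l.getD x 0 + l.getD y 0) = _
  rw [hy]
  rfl

theorem mul (hi : P.getD pc .halt = .mul d x y) (hxy : l.getD x 0 * l.getD y 0 < B)
    (h : Reaches P B Post T ⟨pc + 1, regs (l.set d (l.getD x 0 * l.getD y 0)), μ⟩)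
    (hd : d < l.length := by exact Nat.le_of_ble_eq_true rfl) :
    Reaches P B Post (T + 1) ⟨pc, regs l, μ⟩ :=
  of_set hd (step_eq_exec hi) (fun _ => hxy) h

theorem sub (hi : P.getD pc .halt = .sub d x y)
    (h : Reaches P B Post T ⟨pc + 1, regs (l.set d (l.getD x 0 - l.getD y 0)), μ⟩)
    (hd : d < l.length := by exact Nat.le_of_ble_eq_true rfl) :
    Reaches P B Post (T + 1) ⟨pc, regs l, μ⟩ :=
  of_set hd (step_eq_exec hi) (fun hc => (Nat.sub_le _ _).trans_lt (hc x).1) h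

theorem div (hi : P.getD pc .halt = .div d x y)
    (h : Reaches P B Post T ⟨pc + 1, regs (l.set d (l.getD x 0 / l.getD y 0)), μ⟩)
    (hd : d < l.length := by exact Nat.le_of_ble_eq_true rfl) :
    Reaches P B Post (T + 1) ⟨pc, regs l, μ⟩ :=
  of_set hd (step_eq_exec hi) (fun hc => (Nat.div_le_self _ _).trans_lt (hc x).1) h

theorem load {z : ℕ} (hi : P.getD pc .halt = .load d x) (hz : μ (l.getD x 0) = z)
    (h : Reaches P B Post T ⟨pc + 1, regs (l.set d z), μ⟩)
    (hd : d < l.length := by exact Nat.le_of_ble_eq_true rfl) :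
    Reaches P B Post (T + 1) ⟨pc, regs l, μ⟩ :=
  of_set hd ((step_eq_exec hi).trans (by rw [← hz]; rfl)) (fun hc => hz ▸ (hc _).2) h

theorem store (hi : P.getD pc .halt = .store x y)
    (h : Reaches P B Post T ⟨pc + 1, regs l, Function.update μ (l.getD x 0) (l.getD y 0)⟩) :
    Reaches P B Post (T + 1) ⟨pc, regs l, μ⟩ := by
  refine of_step (fun hc i => ?_) (by rwa [step_eq_exec hi])
  rw [step_eq_exec hi]
  refine ⟨(hc i).1, ?_⟩
  change Function.update μ (l.getD x 0) (l.getD y 0) i < B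
  rcases eq_or_ne i (l.getD x 0) with rfl | hne
  · rw [Function.update_self]
    exact (hc y).1
  · rw [Function.update_of_ne hne]
    exact (hc i).2

theorem jump (hi : P.getD pc .halt = .jump p) (h : Reaches P B Post T ⟨p, regs l, μ⟩) :
    Reaches P B Post (T + 1) ⟨pc, regs l, μ⟩ :=
  of_step (fun hc => by rw [step_eq_exec hi]; exact hc) (by rwa [step_eq_exec hi])

theorem jlt (hi : P.getD pc .halt = .jlt x y p) (hxy : l.getD x 0 < l.getD y 0)
    (h : Reaches P B Post T ⟨p, regs l, μ⟩) : Reaches P B Post (T + 1) ⟨pc, regs l, μ⟩ :=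
  of_step (fun hc => by rw [step_eq_exec hi]; exact hc)
    (by rw [step_eq_exec hi, Instr.exec, if_pos (by exact hxy)]; exact h)

theorem jge (hi : P.getD pc .halt = .jlt x y p) (hxy : l.getD y 0 ≤ l.getD x 0)
    (h : Reaches P B Post T ⟨pc + 1, regs l, μ⟩) : Reaches P B Post (T + 1) ⟨pc, regs l, μ⟩ :=
  of_step (fun hc => by rw [step_eq_exec hi]; exact hc)
    (by rw [step_eq_exec hi, Instr.exec, if_neg (by exact Nat.not_lt.2 hxy)]; exact h)

end Reaches

end RAM

/-! ### The program -/

namespace RAM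

namespace Reg

/-! Registers 0 to 2 hold the output. Register 21 is never written, hence zero. -/

@[simp] abbrev mantissa : ℕ := 0
@[simp] abbrev exponent : ℕ := 1
@[simp] abbrev shift : ℕ := 2
@[simp] abbrev order : ℕ := 3
@[simp] abbrev scale : ℕ := 4
@[simp] abbrev base : ℕ := 5
@[simp] abbrev depth : ℕ := 6
@[simp] abbrev index : ℕ := 7
@[simp] abbrev one : ℕ := 8
@[simp] abbrev two : ℕ := 9
@[simp] abbrev frameSize : ℕ := 10
@[simp] abbrev frame : ℕ := 11
@[simp] abbrev vertex : ℕ := 12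
@[simp] abbrev budget : ℕ := 13
@[simp] abbrev value : ℕ := 14
@[simp] abbrev entry : ℕ := 15
@[simp] abbrev limit : ℕ := 16
@[simp] abbrev neighbor : ℕ := 17
@[simp] abbrev tmp : ℕ := 18
@[simp] abbrev aux : ℕ := 19
@[simp] abbrev result : ℕ := 20
@[simp] abbrev zero : ℕ := 21

end Reg

namespace Label

/-! The positions of the entry points of `counter`. -/

abbrev scaleLoop : ℕ := 20
abbrev accumulate : ℕ := 28
abbrev vertexLoop : ℕ := 37
abbrev call : ℕ := 41
abbrev copyLoop : ℕ := 42
abbrev evaluate : ℕ := 52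
abbrev entryLoop : ℕ := 65
abbrev flagTest : ℕ := 73
abbrev save : ℕ := 78
abbrev leave : ℕ := 90
abbrev resume : ℕ := 93

end Label

open Reg Label in
/-- The program that approximates the number of sink-free orientations by
`2 ^ m * ∏ v, P(v is no sink | no vertex before v is a sink)`.

It first finds the scale `2 ^ shift` of its fixed-point arithmetic, the least power of two with
`4096 * (b / a + 1) * (n + 5) ≤ 2 ^ shift`, and the depth `11 * (shift - 8)`. The factors are
computed by the recursion of `MultiGraph.approx`, on a stack of frames that begins right after the
input. A frame consists of the indicators of the set `S` and, while its call is suspended, of the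
saved registers `budget`, `value`, `entry`, `limit` and `vertex`. The accumulated product is kept in
the mantissa, which is doubled whenever it drops below the scale.

The comments mark the entry points in `Label`. -/
def counter : Program := [
  .load order zero,
  .const one 1,
  .load exponent one,
  .const two 2,
  .const frameSize 5,
  .add frameSize order frameSize,
  .load tmp two,
  .add aux one two,
  .load aux aux,
  .div tmp aux tmp,
  .add tmp tmp one,
  .mul tmp tmp frameSize,
  .sub base frameSize one,
  .load base base,
  .add frame base zero,
  .const scale 4096,
  .mul tmp tmp scale,
  .const shift 12,
  .const depth 44,
  .const aux 11,
  -- scaleLoop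
  .jlt scale tmp 22,
  .jump 26,
  .add scale scale scale,
  .add shift shift one,
  .add depth depth aux,
  .jump scaleLoop,
  .add mantissa scale zero,
  .jump vertexLoop,
  -- accumulate
  .mul mantissa mantissa result,
  .div mantissa mantissa scale,
  .jlt mantissa scale 32,
  .jump 34,
  .add mantissa mantissa mantissa,
  .add shift shift one,
  .add tmp base index,
  .store tmp one,
  .add index index one,
  -- vertexLoop
  .jlt index order 39,
  .halt,
  .add neighbor index zero,
  .add budget depth zero,
  -- call
  .const tmp 0,
  -- copyLoop
  .jlt tmp order 44,
  .jump 50,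
  .add aux frame tmp,
  .load vertex aux,
  .add aux aux frameSize,
  .store aux vertex,
  .add tmp tmp one,
  .jump copyLoop,
  .add frame frame frameSize,
  .add vertex neighbor zero,
  -- evaluate
  .const tmp 4,
  .add tmp tmp vertex,
  .load entry tmp,
  .add tmp tmp one,
  .load limit tmp,
  .sub tmp limit entry,
  .div tmp tmp two,
  .add budget budget two,
  .jlt tmp budget 63,
  .add result scale zero,
  .jump leave,
  .sub budget budget tmp,
  .add value scale zero,
  -- entryLoop
  .jlt entry limit 68,
  .sub result scale value,
  .jump leave,
  .load neighbor entry,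
  .add entry entry two,
  .div value value two,
  .add tmp frame neighbor,
  .load aux tmp,
  -- flagTest
  .jlt zero aux save,
  .jlt neighbor vertex entryLoop,
  .jlt vertex neighbor entryLoop,
  .const value 0,
  .jump entryLoop,
  -- save
  .store tmp zero,
  .add tmp frame order,
  .store tmp budget,
  .add tmp tmp one,
  .store tmp value,
  .add tmp tmp one,
  .store tmp entry,
  .add tmp tmp one,
  .store tmp limit,
  .add tmp tmp one,
  .store tmp vertex,
  .jump call,
  -- leave
  .sub frame frame frameSize,
  .jlt base frame resume,
  .jump accumulate,
  -- resume
  .add tmp frame order,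
  .load budget tmp,
  .add tmp tmp one,
  .load value tmp,
  .add tmp tmp one,
  .load entry tmp,
  .add tmp tmp one,
  .load limit tmp,
  .add tmp tmp one,
  .load vertex tmp,
  .mul value value scale,
  .div value value result,
  .jump entryLoop]

/-- The contents of the registers that do not change during the evaluation of
`MultiGraph.approx`. -/
structure Env where
  mantissa : ℕ
  exponent : ℕ
  shift : ℕ
  order : ℕ
  scale : ℕ
  base : ℕ
  depth : ℕ
  index : ℕ

/-- The contents of all registers in use; the registers from `frame` on are those that change during
the evaluation of `MultiGraph.approx`. -/
abbrev Env.file (E : Env) (f v k y ptr limit u t s x : ℕ) : List ℕ :=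
  [E.mantissa, E.exponent, E.shift, E.order, E.scale, E.base, E.depth, E.index, 1, 2, E.order + 5,
    f, v, k, y, ptr, limit, u, t, s, x]

/-- The set `S` of vertices is stored from the address `a` on, as the list of its indicators. -/
def StoresSet (μ : ℕ → ℕ) (a : ℕ) {n : ℕ} (S : Finset (Fin n)) : Prop :=
  ∀ w : Fin n, μ (a + w) = if w ∈ S then 1 else 0

/-- The words `l` are stored from the address `a` on. -/
def StoresList (μ : ℕ → ℕ) (a : ℕ) (l : List ℕ) : Prop := ∀ i < l.length, μ (a + i) = l.getD i 0

open Set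

theorem StoresSet.congr {μ μ' : ℕ → ℕ} {a b n : ℕ} {S : Finset (Fin n)} (h : StoresSet μ a S)
    (hμ : EqOn μ' μ (Iio b)) (hb : a + n ≤ b) : StoresSet μ' a S :=
  fun w => (hμ (by have := w.2; simp only [mem_Iio]; omega)).trans (h w)

theorem StoresList.congr {μ μ' : ℕ → ℕ} {a b : ℕ} {l : List ℕ} (h : StoresList μ a l)
    (hμ : EqOn μ' μ (Iio b)) (hb : a + l.length ≤ b) : StoresList μ' a l :=
  fun i hi => (hμ (by simp only [mem_Iio]; omega)).trans (h i hi)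

variable {B : ℕ} {Post : Config → Prop} (E : Env) {T f v k y ptr limit s x : ℕ} {μ : ℕ → ℕ}

theorem reaches_of_copyLoop {u : ℕ} (hf : f + 2 * (E.order + 5) < B)
    (h : ∀ μ' v t s, EqOn μ' μ (Iio (f + (E.order + 5))) →
      (∀ w < E.order, μ' (f + (E.order + 5) + w) = μ (f + w)) →
      Reaches counter B Post T ⟨50, regs (E.file f v k y ptr limit u t s x), μ'⟩) (r : ℕ) :
    ∀ j v s μ', j + r = E.order → EqOn μ' μ (Iio (f + (E.order + 5))) →
      (∀ w < j, μ' (f + (E.order + 5) + w) = μ (f + w)) →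
      Reaches counter B Post (T + 7 * r + 2)
        ⟨Label.copyLoop, regs (E.file f v k y ptr limit u j s x), μ'⟩ := by
  induction r with
  | zero =>
    intro j v s μ' hj hlow hcopy
    refine .jge rfl (by simp; omega) (.jump rfl ?_)
    exact h _ _ _ _ hlow fun w hw => hcopy w (by omega)
  | succ r ih =>
    intro j v s μ' hj hlow hcopy
    have hlow' : ∀ a < f + (E.order + 5), μ' a = μ a := fun a ha => hlow ha
    refine .jlt rfl (by simp; omega) (.add rfl (by simp; omega) (.load rfl rfl
      (.add rfl (by simp; omega) (.store rfl (.add rfl (by simp; omega) (.jump rfl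
      (ih (j + 1) _ _ _ (by omega) (fun a ha => ?_) fun w hw => ?_)))))))
    · rw [mem_Iio] at ha
      exact (Function.update_of_ne (by simp; omega) _ _).trans (hlow ha)
    · rcases eq_or_ne w j with rfl | hwj
      · rw [show f + (E.order + 5) + w = f + w + (E.order + 5) by omega]
        exact (Function.update_self _ _ _).trans (hlow' (f + w) (by omega))
      · exact (Function.update_of_ne (by simp; omega) _ _).trans (hcopy w (by omega))

theorem reaches_of_save {S : Finset (Fin E.order)} (hS : StoresSet μ f S) {u : Fin E.order}
    (hf : f + (E.order + 5) < B)
    (h : ∀ μ' t, EqOn μ' μ (Iio f) → StoresSet μ' f (S.erase u) →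
      StoresList μ' (f + E.order) [k, y, ptr, limit, v] →
      Reaches counter B Post T ⟨Label.call, regs (E.file f v k y ptr limit u t s x), μ'⟩) :
    Reaches counter B Post (T + 12)
      ⟨Label.save, regs (E.file f v k y ptr limit u (f + u) s x), μ⟩ := by
  have hu := u.2
  refine .store rfl (.add rfl (by simp; omega) (.store rfl (.add rfl (by simp; omega)
    (.store rfl (.add rfl (by simp; omega) (.store rfl (.add rfl (by simp; omega)
    (.store rfl (.add rfl (by simp; omega) (.store rfl (.jump rfl ?_)))))))))))
  refine h (Function.update (Function.update (Function.update (Function.update (Function.update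
    (Function.update μ (f + u) 0) (f + E.order) k) (f + E.order + 1) y) (f + E.order + 1 + 1) ptr)
    (f + E.order + 1 + 1 + 1) limit) (f + E.order + 1 + 1 + 1 + 1) v) _ (fun a ha => ?_)
    (fun w => ?_) fun i hi => ?_
  · rw [mem_Iio] at ha
    simp (disch := omega) only [Function.update_of_ne]
  · have hw := w.2
    rcases eq_or_ne w u with rfl | hwu
    · simp (disch := omega) [Function.update_of_ne]
    · have hwu' := Fin.val_ne_of_ne hwu
      simp (disch := omega) only [Function.update_of_ne, hS w, Finset.mem_erase, ne_eq, hwu,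
        not_false_eq_true, true_and]
  · change i < 5 at hi
    interval_cases i <;> simp (disch := omega) [Function.update_of_ne]

theorem reaches_of_resume {v' k' y' ptr' limit' u t : ℕ} (hf : f + (E.order + 5) < B)
    (hframe : StoresList μ (f + E.order) [k, y, ptr, limit, v]) (hy : y * E.scale < B)
    (h : ∀ t, Reaches counter B Post T
      ⟨Label.entryLoop, regs (E.file f v k (y * E.scale / x) ptr limit u t s x), μ⟩) :
    Reaches counter B Post (T + 13)
      ⟨Label.resume, regs (E.file f v' k' y' ptr' limit' u t s x), μ⟩ := by
  refine .add rfl (by simp; omega) (.load (z := k) rfl (hframe 0 (by simp))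
    (.add rfl (by simp; omega) (.load (z := y) rfl (hframe 1 (by simp)) ?_)))
  change Reaches _ _ _ _ ⟨97, regs (E.file f v' k y ptr' limit' u (f + E.order + 1) s x), μ⟩
  refine .add rfl (by simp; omega) (.load (z := ptr) rfl (hframe 2 (by simp))
    (.add rfl (by simp; omega) (.load (z := limit) rfl (hframe 3 (by simp)) ?_)))
  change Reaches _ _ _ _ ⟨101, regs (E.file f v' k y ptr limit u (f + E.order + 3) s x), μ⟩
  exact .add rfl (by simp; omega) (.load (z := v) rfl (hframe 4 (by simp))
    (.mul rfl hy (.div rfl (.jump rfl (h _)))))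

end RAM

/-! ### The recursion -/

namespace RAM

open MultiGraph Set

/-- The vertices `l` are stored at the addresses `a`, `a + 2`, `a + 4`, … -/
def StoresEntries {n : ℕ} (μ : ℕ → ℕ) : ℕ → List (Fin n) → Prop
  | _, [] => True
  | a, u :: l => μ a = u ∧ StoresEntries μ (a + 2) l

/-- The memory `inp` holds the adjacency list `L` below the address `base`. -/
structure Holds {n m : ℕ} {G : MultiGraph n m} (L : G.AdjList) (base : ℕ) (inp : ℕ → ℕ) : Prop where
  header_le : n + 5 ≤ base
  start_add (v : Fin n) : inp (4 + v) + 2 * (L.neighbors v).length = inp (4 + v + 1)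
  limit_le (v : Fin n) : inp (4 + v + 1) ≤ base
  entries (v : Fin n) : StoresEntries inp (inp (4 + v)) (L.neighbors v)

variable {B : ℕ} {Post : Config → Prop} {E : Env} {T f v k y ptr limit t s x : ℕ} {μ : ℕ → ℕ}

/-- Below `E.base` there is the input `inp`, and the frame at `f` describes the set `S`. -/
structure HoldsFrame (E : Env) (inp : ℕ → ℕ) (f : ℕ) (S : Finset (Fin E.order)) (μ : ℕ → ℕ) :
    Prop where
  input : EqOn μ inp (Iio E.base)
  flags : StoresSet μ f S

/-- The goal is reached if the evaluation in the frame at `f`, begun with the memory `μ`, returns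
the result `z`, whatever happens to the memory from `f` on. -/
def Returns (B : ℕ) (Post : Config → Prop) (E : Env) (T f z : ℕ) (μ : ℕ → ℕ) : Prop :=
  ∀ μ' v k y ptr limit u t s, EqOn μ' μ (Iio f) →
    Reaches counter B Post T ⟨Label.leave, regs (E.file f v k y ptr limit u t s z), μ'⟩

theorem Returns.congr {z : ℕ} {μ' : ℕ → ℕ} (h : Returns B Post E T f z μ)
    (hμ : EqOn μ' μ (Iio f)) : Returns B Post E T f z μ' :=
  fun _ _ _ _ _ _ _ _ _ hμ' => h _ _ _ _ _ _ _ _ _ (hμ'.trans hμ)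

/-- From the position `Label.evaluate` on, the program computes `MultiGraph.approx` with budget
`k`. -/
def Evaluates (B : ℕ) (Post : Config → Prop) (E : Env) {m : ℕ} {G : MultiGraph E.order m}
    (L : G.AdjList) (inp : ℕ → ℕ) (k : ℕ) : Prop :=
  ∀ (T f y ptr limit u t s x : ℕ) (μ : ℕ → ℕ) (S : Finset (Fin E.order)) (v : Fin E.order),
    v ∉ S → E.base < f → f + (k + 2) * (E.order + 5) < B → HoldsFrame E inp f S μ →
    Returns B Post E T f (approx L.neighbors E.scale k S v) μ →
    Reaches counter B Post (T + (7 * E.order + 40) * 4 ^ k)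
      ⟨Label.evaluate, regs (E.file f v k y ptr limit u t s x), μ⟩

variable {m : ℕ} {G : MultiGraph E.order m} {L : G.AdjList} {inp : ℕ → ℕ}
  {S : Finset (Fin E.order)}

theorem Evaluates.call (hk : Evaluates B Post E L inp k) {u : Fin E.order} (hu : u ∉ S)
    (hf : E.base ≤ f) (hB : f + (k + 3) * (E.order + 5) < B) (hμ : HoldsFrame E inp f S μ)
    (h : Returns B Post E T (f + (E.order + 5)) (approx L.neighbors E.scale k S u) μ) :
    Reaches counter B Post (T + (7 * E.order + 40) * 4 ^ k + 2 + 7 * E.order + 2 + 1)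
      ⟨Label.call, regs (E.file f v k y ptr limit u t s x), μ⟩ := by
  have hB' : f + (E.order + 5) + (k + 2) * (E.order + 5) < B := by
    rw [show k + 3 = k + 2 + 1 from rfl, Nat.succ_mul] at hB
    omega
  have hle : 2 * (E.order + 5) ≤ (k + 2) * (E.order + 5) := Nat.mul_le_mul_right _ (by omega)
  refine .const rfl (by omega) (reaches_of_copyLoop E (μ := μ) (by omega)
    (fun μ' v t s hlow hcopy => ?_) E.order 0 _ _ _ (Nat.zero_add _) (fun _ _ => rfl)
    fun w hw => absurd hw w.not_lt_zero)
  refine .add rfl (by simp; omega) (.copy rfl rfl ?_)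
  exact hk _ (f + (E.order + 5)) _ _ _ _ _ _ _ μ' S u hu (by omega) hB'
    ⟨fun a ha => (hlow (by simp only [mem_Iio] at ha ⊢; omega)).trans (hμ.input ha),
      fun w => (hcopy w w.2).trans (hμ.flags w)⟩
    (h.congr hlow)

theorem Evaluates.recurse (hk : Evaluates B Post E L inp k) {u : Fin E.order}
    (hf : E.base < f) (hB : f + (k + 3) * (E.order + 5) < B) (hμ : HoldsFrame E inp f S μ)
    (hy : y * E.scale < B)
    (h : ∀ μ' u' t s x, EqOn μ' μ (Iio f) → HoldsFrame E inp f (S.erase u) μ' →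
      Reaches counter B Post T ⟨Label.entryLoop, regs (E.file f v k
        (y * E.scale / approx L.neighbors E.scale k (S.erase u) u) ptr limit u' t s x), μ'⟩) :
    Reaches counter B Post (T + (7 * E.order + 40) * 4 ^ k + (7 * E.order + 32))
      ⟨Label.save, regs (E.file f v k y ptr limit u (f + u) s x), μ⟩ := by
  have hB' : f + (E.order + 5) < B :=
    (Nat.add_le_add_left (Nat.le_mul_of_pos_left _ (by omega)) _).trans_lt hB
  refine .mono (T := T + 13 + 2 + (7 * E.order + 40) * 4 ^ k + 2 + 7 * E.order + 2 + 1 + 12) ?_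
    (by omega)
  refine reaches_of_save E hμ.flags hB' fun μ' t hlow hflags hframe => ?_
  have hμ' : HoldsFrame E inp f (S.erase u) μ' :=
    ⟨(hlow.mono (Iio_subset_Iio hf.le)).trans hμ.input, hflags⟩
  refine hk.call (Finset.notMem_erase u S) hf.le hB hμ'
    fun μ'' v' k' y' ptr' limit' u' t s hlow' => ?_
  refine .sub rfl ?_
  change Reaches _ _ _ _ ⟨_, regs (E.file (f + (E.order + 5) - (E.order + 5)) _ _ _ _ _ _ _ _ _), _⟩
  rw [Nat.add_sub_cancel]
  refine .jlt rfl hf (reaches_of_resume E hB' (hframe.congr hlow' (by simp; omega)) hy fun t => ?_)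
  have hlow'' : EqOn μ'' μ' (Iio f) := hlow'.mono (Iio_subset_Iio (Nat.le_add_right _ _))
  exact h μ'' _ _ _ _ (hlow''.trans hlow)
    ⟨(hlow''.mono (Iio_subset_Iio hf.le)).trans hμ'.input, hflags.congr hlow' (by omega)⟩

theorem reaches_of_fetch (hS : StoresSet μ f S) {u : Fin E.order} (hu : μ ptr = u) {u' : ℕ}
    (hptr : ptr < limit) (hB : ptr + 2 < B) (hf : f + E.order < B)
    (h : Reaches counter B Post T ⟨Label.flagTest,
      regs (E.file f v k (y / 2) (ptr + 2) limit u (f + u) (if u ∈ S then 1 else 0) x), μ⟩) :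
    Reaches counter B Post (T + 6)
      ⟨Label.entryLoop, regs (E.file f v k y ptr limit u' t s x), μ⟩ :=
  .jlt rfl hptr (.load rfl hu (.add rfl hB (.div rfl (.add rfl
    ((Nat.add_lt_add_left u.2 f).trans hf) (.load rfl (hS u) h)))))

theorem reaches_of_skip {u : ℕ} (hB : 0 < B)
    (h : ∀ s, Reaches counter B Post T ⟨Label.entryLoop,
      regs (E.file f v k (if u = v then 0 else y) ptr limit u t s x), μ⟩) :
    Reaches counter B Post (T + 5)
      ⟨Label.flagTest, regs (E.file f v k y ptr limit u t 0 x), μ⟩ := by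
  refine .jge rfl le_rfl ?_
  rcases lt_trichotomy u v with hlt | rfl | hgt
  · rw [if_neg hlt.ne] at h
    exact .mono (T := T + 1) (.jlt rfl hlt (h _)) (by omega)
  · rw [if_pos rfl] at h
    exact .jge rfl le_rfl (.jge rfl le_rfl (.const rfl hB (.jump rfl (h _))))
  · rw [if_neg hgt.ne'] at h
    exact .mono (T := T + 2) (.jge rfl hgt.le (.jlt rfl hgt (h _))) (by omega)

theorem Evaluates.visit (hk : Evaluates B Post E L inp k) {v u : Fin E.order} {u' : ℕ}
    (hf : E.base < f) (hB : f + (k + 3) * (E.order + 5) < B) (hμ : HoldsFrame E inp f S μ)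
    (hy : y * E.scale < B) (hu : μ ptr = u) (hptr : ptr < limit) (hlimit : limit ≤ E.base)
    (h : ∀ μ' u' t s x, EqOn μ' μ (Iio f) → HoldsFrame E inp f (S.erase u) μ' →
      Reaches counter B Post T ⟨Label.entryLoop, regs (E.file f v k
        (visit (approx L.neighbors E.scale k) E.scale v S y u) (ptr + 2) limit u' t s x), μ'⟩) :
    Reaches counter B Post (T + (7 * E.order + 40 + (7 * E.order + 40) * 4 ^ k))
      ⟨Label.entryLoop, regs (E.file f v k y ptr limit u' t s x), μ⟩ := by
  have hB' : 3 * (E.order + 5) ≤ (k + 3) * (E.order + 5) := Nat.mul_le_mul_right _ (by omega)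
  by_cases huS : u ∈ S
  · refine .mono (T := T + (7 * E.order + 40) * 4 ^ k + (7 * E.order + 32) + 1 + 6) ?_ (by omega)
    refine reaches_of_fetch hμ.flags hu hptr (by omega) (by omega) ?_
    rw [if_pos huS]
    simp only [MultiGraph.visit, if_pos huS] at h
    exact .jlt rfl Nat.zero_lt_one (hk.recurse hf hB hμ
      ((Nat.mul_le_mul_right _ (Nat.div_le_self _ _)).trans_lt hy) h)
  · refine .mono (T := T + 5 + 6) ?_ (by omega)
    refine reaches_of_fetch hμ.flags hu hptr (by omega) (by omega) ?_
    rw [if_neg huS]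
    simp only [MultiGraph.visit, if_neg huS, Fin.ext_iff] at h
    refine reaches_of_skip (by omega) fun s => h μ _ _ _ _ (fun _ _ => rfl) ?_
    rwa [Finset.erase_eq_of_notMem huS]

theorem Evaluates.entryLoop (hk : Evaluates B Post E L inp k) (hdeg : ∀ v, 3 ≤ G.degree v)
    (hscale : E.scale * E.scale < B) (hf : E.base < f) (hB : f + (k + 3) * (E.order + 5) < B)
    (hlimit : limit ≤ E.base) {v : Fin E.order} {l : List (Fin E.order)}
    (hl : ∀ u ∈ l, u ∈ G.nbrs v) {u : ℕ} (hv : v ∉ S) (hy : y ≤ E.scale)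
    (hptr : ptr + 2 * l.length = limit) (hentries : StoresEntries inp ptr l)
    (hμ : HoldsFrame E inp f S μ)
    (h : Returns B Post E T f
      (E.scale - sweep (approx L.neighbors E.scale k) E.scale v l S y) μ) :
    Reaches counter B Post
      (T + 3 + l.length * (7 * E.order + 40 + (7 * E.order + 40) * 4 ^ k))
      ⟨Label.entryLoop, regs (E.file f v k y ptr limit u t s x), μ⟩ := by
  induction l generalizing S y ptr u t s x μ with
  | nil =>
    refine .mono (T := T + 3) ?_ (by omega)
    exact .jge rfl hptr.ge (.sub rfl (.jump rfl (h _ _ _ _ _ _ _ _ _ fun _ _ => rfl)))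
  | cons w l ih =>
    rw [List.forall_mem_cons] at hl
    rw [List.length_cons] at hptr ⊢
    have hread : μ ptr = w :=
      (hμ.input (by simp only [mem_Iio]; omega)).trans hentries.1
    rw [Nat.succ_mul, ← Nat.add_assoc]
    refine hk.visit hf hB hμ ((Nat.mul_le_mul_right _ hy).trans_lt hscale) hread (by omega) hlimit
      fun μ' u' t s x hlow hμ' => ih hl.2 (fun hv' => hv (Finset.mem_of_mem_erase hv')) ?_
        (by omega) hentries.2 hμ' (h.congr hlow)
    have hvisit := visit_le (lowerBound_approx hdeg L E.scale k v) hv hl.1 y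
    have hy' : (y : ℝ) ≤ E.scale := mod_cast hy
    exact_mod_cast hvisit.trans (by linarith [Nat.cast_nonneg (α := ℝ) y] : _ ≤ (E.scale : ℝ))

theorem one_add_mul_four_pow_le {d k : ℕ} (hd : 3 ≤ d) (hk : d < k + 2) :
    1 + d + d * 4 ^ (k + 2 - d) ≤ 4 ^ k := by
  obtain ⟨c, rfl⟩ : ∃ c, d = c + 3 := ⟨d - 3, by omega⟩
  obtain ⟨j, rfl⟩ : ∃ j, k = j + 1 + (c + 1) := ⟨k - c - 2, by omega⟩
  rw [show j + 1 + (c + 1) + 2 - (c + 3) = j + 1 by omega, pow_add 4 (j + 1)]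
  have hc : 5 * c + 16 ≤ 4 * 4 ^ (c + 1) := by
    clear hd hk
    induction c with
    | zero => norm_num
    | succ c ih => rw [pow_succ]; omega
  have hj : 4 ≤ 4 ^ (j + 1) := Nat.le_self_pow (Nat.succ_ne_zero j) 4
  nlinarith [Nat.mul_le_mul hj hc, Nat.mul_le_mul_left (4 ^ (j + 1)) hc]

theorem reaches_of_loadDegree (hinp : Holds L E.base inp) (hμ : EqOn μ inp (Iio E.base))
    {v : Fin E.order} {u : ℕ} (hB : E.base < B) (hk : k + 2 < B)
    (h : Reaches counter B Post T ⟨60, regs (E.file f v (k + 2) y (inp (4 + v)) (inp (4 + v + 1)) u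
      (L.neighbors v).length s x), μ⟩) :
    Reaches counter B Post (T + 8)
      ⟨Label.evaluate, regs (E.file f v k y ptr limit u t s x), μ⟩ := by
  have hv := v.2
  have hbase := hinp.header_le
  have hlength : (inp (4 + v + 1) - inp (4 + v)) / 2 = (L.neighbors v).length := by
    have := hinp.start_add v
    omega
  refine .const rfl (by omega) (.add rfl (by simp; omega) (.load (z := inp (4 + v)) rfl
    (hμ (by simp; omega)) (.add rfl (by simp; omega) ?_)))
  change Reaches _ _ _ _ ⟨56, regs (E.file f v k y (inp (4 + v)) limit u (4 + v + 1) s x), μ⟩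
  refine .load (z := inp (4 + v + 1)) rfl (hμ (by simp; omega)) (.sub rfl (.div rfl ?_))
  change Reaches _ _ _ _ ⟨59, regs (E.file f v k y (inp (4 + v)) (inp (4 + v + 1)) u
    ((inp (4 + v + 1) - inp (4 + v)) / 2) s x), μ⟩
  rw [hlength]
  exact .add rfl hk h

theorem evaluates (hdeg : ∀ v, 3 ≤ G.degree v) (hinp : Holds L E.base inp)
    (hscale : E.scale * E.scale < B) (hbase : E.base < B) (k : ℕ) : Evaluates B Post E L inp k := by
  induction k using Nat.strong_induction_on with
  | _ k ih =>
  intro T f y ptr limit u t s x μ S v hv hf hB hμ h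
  have hk : k + 2 ≤ (k + 2) * (E.order + 5) := Nat.le_mul_of_pos_right _ (by omega)
  have hd : 3 ≤ (L.neighbors v).length := (hdeg v).trans_eq (L.length_neighbors v).symm
  rw [approx] at h
  by_cases hcut : k + 2 ≤ (L.neighbors v).length
  · rw [dif_pos (Or.inl hcut)] at h
    have hW : 7 * E.order + 40 ≤ (7 * E.order + 40) * 4 ^ k :=
      Nat.le_mul_of_pos_right _ (by positivity)
    refine .mono (T := T + 3 + 8) ?_ (by omega)
    refine reaches_of_loadDegree hinp hμ.input hbase (by omega) ?_
    exact .jge rfl hcut (.copy rfl rfl (.jump rfl (h _ _ _ _ _ _ _ _ _ fun _ _ => rfl)))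
  · rw [dif_neg (by omega)] at h
    have htime := Nat.mul_le_mul_left (7 * E.order + 40)
      (one_add_mul_four_pow_le (k := k) hd (by omega))
    have hB' : f + (k + 2 - (L.neighbors v).length + 3) * (E.order + 5) < B :=
      (Nat.add_le_add_left (Nat.mul_le_mul_right _ (by omega)) _).trans_lt hB
    refine .mono (T := T + 3 + (L.neighbors v).length * (7 * E.order + 40 +
      (7 * E.order + 40) * 4 ^ (k + 2 - (L.neighbors v).length)) + 3 + 8) ?_ (by nlinarith)
    refine reaches_of_loadDegree hinp hμ.input hbase (by omega) ?_
    refine .jlt rfl (not_le.1 hcut) (.sub rfl (.copy rfl rfl ?_))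
    exact (ih _ (by omega)).entryLoop hdeg hscale hf hB' (hinp.limit_le v)
      (fun u hu => L.mem_neighbors.1 hu) hv le_rfl (hinp.start_add v) (hinp.entries v) hμ h

end RAM

/-! ### The encoding of the input -/

open MultiGraph in
theorem RAM.storesEntries_append {n m : ℕ} (pre post : List ℕ) (l : List (Fin n × Fin m)) :
    StoresEntries (fun i => (pre ++ (l.flatMap fun p => [p.1.val, p.2.val]) ++ post).getD i 0)
      pre.length (l.map Prod.fst) := by
  induction l generalizing pre with
  | nil => trivial
  | cons p l ih => exact ⟨by simp, by simpa using ih (pre ++ [p.1.val, p.2.val])⟩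

namespace MultiGraph

variable {n m : ℕ} {G : MultiGraph n m} (L : G.AdjList) (a b : ℕ)

/-- The initial memory. -/
def AdjList.memory : ℕ → ℕ := fun i => (L.encode a b).getD i 0

/-- The vertices whose number is less than `j`. -/
def below (n j : ℕ) : Finset (Fin n) := {v | v.val < j}

theorem mem_below {j : ℕ} {v : Fin n} : v ∈ below n j ↔ v.val < j := by simp [below]

theorem insert_below (v : Fin n) : insert v (below n v) = below n (v + 1) := by
  ext u
  rw [Finset.mem_insert, mem_below, mem_below, Fin.ext_iff, Nat.lt_succ_iff_lt_or_eq, or_comm]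

theorem AdjList.offset_eq (j : ℕ) :
    L.offset j = n + 5 + 2 * ∑ v ∈ below n j, (L.list v).length := rfl

theorem AdjList.offset_succ (v : Fin n) :
    L.offset (v + 1) = L.offset v + 2 * (L.list v).length := by
  rw [L.offset_eq, L.offset_eq, ← insert_below, Finset.sum_insert (by simp [mem_below])]
  ring

theorem AdjList.offset_mono : Monotone L.offset := fun i j h => by
  unfold offset
  gcongr

theorem AdjList.offset_order : L.offset n = n + 5 + 4 * m := by
  have hsum : ∑ v, (G.endsAt v).card = 2 * m := by
    have h := Finset.card_eq_sum_card_fiberwise (s := (Finset.univ : Finset (Fin m × Bool)))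
      (t := (Finset.univ : Finset (Fin n))) (f := fun d => G.endpoint d.1 d.2) (by simp)
    rw [Finset.card_univ, Fintype.card_prod, Fintype.card_fin, Fintype.card_bool] at h
    rw [mul_comm, h]
    rfl
  simp only [offset, L.length_list, degree, Fin.is_lt, Finset.filter_true, hsum]
  ring

theorem AdjList.length_flatMap_take {j : ℕ} (hj : j ≤ n) :
    n + 5 + (((List.finRange n).take j).flatMap fun v =>
      (L.list v).flatMap fun p => [p.1.val, p.2.val]).length = L.offset j := by
  induction j with
  | zero => simp [offset]
  | succ j ih =>
    have h := L.offset_succ ⟨j, hj⟩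
    simp only [← ih (Nat.le_of_lt hj)] at h
    rw [h, List.take_add_one, List.getElem?_eq_getElem (by simpa using hj)]
    simp [List.length_flatMap, mul_comm, add_assoc]

theorem AdjList.memory_offset {i : ℕ} (hi : i ≤ n) : L.memory a b (4 + i) = L.offset i := by
  rw [memory, encode, List.append_assoc, List.getD_append_right _ _ _ _ (by simp),
    List.getD_append _ _ _ _ (by simp; omega)]
  simp [List.getD, List.getElem?_range (show i < n + 1 by omega)]

theorem AdjList.storesEntries_memory (v : Fin n) :
    RAM.StoresEntries (L.memory a b) (L.offset v) (L.neighbors v) := by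
  have hsplit : List.finRange n =
      (List.finRange n).take v ++ v :: (List.finRange n).drop (v + 1) := by
    conv_lhs => rw [← List.take_append_drop v (List.finRange n)]
    rw [List.drop_eq_getElem_cons (by simp)]
    simp
  have hlength := L.length_flatMap_take v.2.le
  have h := RAM.storesEntries_append
    ([n, m, a, b] ++ (List.range (n + 1)).map L.offset ++ ((List.finRange n).take v).flatMap
      fun v => (L.list v).flatMap fun p => [p.1.val, p.2.val])
    (((List.finRange n).drop (v + 1)).flatMap fun v =>
      (L.list v).flatMap fun p => [p.1.val, p.2.val]) (L.list v)
  convert h using 1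
  · funext i
    rw [memory, encode]
    conv_lhs => rw [hsplit]
    simp only [List.flatMap_append, List.flatMap_cons, List.append_assoc]
  · rw [← hlength]
    simp only [List.length_append, List.length_cons, List.length_nil, List.length_map,
      List.length_range]
    ring
  · rfl

theorem AdjList.holds : RAM.Holds L (L.offset n) (L.memory a b) where
  header_le := by
    rw [L.offset_order]
    omega
  start_add v := by
    rw [L.memory_offset a b v.2.le, add_assoc, L.memory_offset a b v.2, L.offset_succ,
      neighbors, List.length_map]
  limit_le v := by
    rw [add_assoc, L.memory_offset a b v.2]
    exact L.offset_mono v.2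
  entries v := by
    rw [L.memory_offset a b v.2.le]
    exact L.storesEntries_memory a b v

theorem AdjList.length_encode : (L.encode a b).length = L.offset n := by
  rw [← L.length_flatMap_take le_rfl, encode, List.take_of_length_le (by simp)]
  simp only [List.length_append, List.length_cons, List.length_nil, List.length_map,
    List.length_range]
  ring

theorem AdjList.memory_of_le {i : ℕ} (hi : L.offset n ≤ i) : L.memory a b i = 0 :=
  List.getD_eq_default _ _ ((L.length_encode a b).trans_le hi)

theorem AdjList.memory_lt {B : ℕ} (ha : a < B) (hb : b < B) (hB : L.offset n < B) (i : ℕ) :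
    L.memory a b i < B := by
  have horder := L.offset_order
  rcases lt_or_ge i (L.encode a b).length with hi | hi
  · have hmem := List.getElem_mem hi
    rw [memory, List.getD_eq_getElem _ _ hi]
    generalize (L.encode a b)[i] = x at hmem
    simp only [encode, List.mem_append, List.mem_cons, List.not_mem_nil, or_false, List.mem_map,
      List.mem_range, List.mem_flatMap, List.mem_finRange, true_and] at hmem
    obtain ((rfl | rfl | rfl | rfl) | ⟨i, hi, rfl⟩) | ⟨v, p, -, rfl | rfl⟩ := hmem
    · omega
    · omega
    · exact ha
    · exact hb
    · exact (L.offset_mono (Nat.lt_succ_iff.1 hi)).trans_lt hB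
    · exact p.1.2.trans (by omega)
    · exact p.2.2.trans (by omega)
  · rw [L.memory_of_le a b (by rwa [← L.length_encode a b])]
    omega

end MultiGraph

/-! ### The loop over the vertices -/

namespace MultiGraph

variable {n m : ℕ} {G : MultiGraph n m} {δ : ℝ} {S : Finset (Fin n)} {M F : ℕ}

open Set in
/-- The floating point number `M * 2 ^ m / 2 ^ F` agrees with `G.avoid S` up to one relative error
`δ` for each vertex of `S`. -/
def Approximates (G : MultiGraph n m) (δ : ℝ) (S : Finset (Fin n)) (M F : ℕ) : Prop :=
  (M * 2 ^ m / 2 ^ F : ℝ) ∈ Icc ((1 - δ) ^ S.card * G.avoid S) ((1 + δ) ^ S.card * G.avoid S)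

theorem Approximates.double (h : Approximates G δ S M F) :
    Approximates G δ S (M + M) (F + 1) := by
  have hvalue : ((M + M : ℕ) : ℝ) * 2 ^ m / 2 ^ (F + 1) = M * 2 ^ m / 2 ^ F := by
    rw [Nat.cast_add, pow_succ]
    field_simp
    ring
  rwa [Approximates, hvalue]

theorem Approximates.insert (hdeg : ∀ v, 3 ≤ G.degree v) (h : Approximates G δ S M F)
    (hδ : |δ| ≤ 1) {v : Fin n} (hv : v ∉ S) {M' : ℕ}
    (hM' : |(M' : ℝ) - M * G.ratio S v| ≤ δ * (M * G.ratio S v)) :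
    Approximates G δ (insert v S) M' F := by
  have hp : (0 : ℝ) ≤ 2 ^ m / 2 ^ F := by positivity
  have hr : 0 ≤ G.ratio S v :=
    (by norm_num : (0 : ℝ) ≤ 3 / 4).trans (three_quarters_le_ratio hdeg hv)
  rw [abs_le] at hδ hM'
  rw [Approximates, Finset.card_insert_of_notMem hv, avoid_insert_eq hdeg]
  constructor
  · calc (1 - δ) ^ (S.card + 1) * (G.ratio S v * G.avoid S)
        = (1 - δ) * G.ratio S v * ((1 - δ) ^ S.card * G.avoid S) := by ring
      _ ≤ (1 - δ) * G.ratio S v * (M * 2 ^ m / 2 ^ F) :=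
        mul_le_mul_of_nonneg_left h.1 (mul_nonneg (by linarith) hr)
      _ = (M * G.ratio S v - δ * (M * G.ratio S v)) * (2 ^ m / 2 ^ F) := by ring
      _ ≤ M' * (2 ^ m / 2 ^ F) := mul_le_mul_of_nonneg_right (by linarith) hp
      _ = _ := by ring
  · calc (M' * 2 ^ m / 2 ^ F : ℝ) = M' * (2 ^ m / 2 ^ F) := by ring
      _ ≤ (M * G.ratio S v + δ * (M * G.ratio S v)) * (2 ^ m / 2 ^ F) :=
        mul_le_mul_of_nonneg_right (by linarith) hp
      _ = (1 + δ) * G.ratio S v * (M * 2 ^ m / 2 ^ F) := by ring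
      _ ≤ (1 + δ) * G.ratio S v * ((1 + δ) ^ S.card * G.avoid S) :=
        mul_le_mul_of_nonneg_left h.2 (mul_nonneg (by linarith) hr)
      _ = _ := by ring

theorem abs_cast_mul_div_sub_le {Q x : ℕ} {r η : ℝ} (hQ : 0 < Q) (hM : Q ≤ M)
    (hx : |(x : ℝ) / Q - r| ≤ η) : |((M * x / Q : ℕ) : ℝ) - M * r| ≤ M * (η + 1 / Q) := by
  have hQ' : (0 : ℝ) < Q := mod_cast hQ
  have hround : |((M * x / Q : ℕ) : ℝ) - M * (x / Q)| ≤ M * (1 / Q) := by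
    have hup : ((M * x / Q : ℕ) : ℝ) ≤ (M * x : ℕ) / Q := Nat.cast_div_le
    have hlo := sub_one_le_cast_div (M * x) Q
    have hone : 1 ≤ (M : ℝ) * (1 / Q) := by
      rw [mul_one_div, one_le_div hQ']
      exact_mod_cast hM
    rw [Nat.cast_mul, mul_div_assoc] at hup hlo
    rw [abs_le]
    constructor <;> linarith
  calc |((M * x / Q : ℕ) : ℝ) - M * r|
      ≤ |((M * x / Q : ℕ) : ℝ) - M * (x / Q)| + |M * (x / Q) - M * r| := abs_sub_le _ _ _
    _ ≤ M * (1 / Q) + M * η := by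
      rw [← mul_sub, abs_mul, Nat.abs_cast]
      gcongr
    _ = M * (η + 1 / Q) := by ring

variable {L : G.AdjList} {Q k : ℕ}

theorem Approximates.mul_approx (hdeg : ∀ v, 3 ≤ G.degree v) (h : Approximates G δ S M F)
    (hδ : |δ| ≤ 1) (hk : 4 / 3 * ((15 / 16) ^ k + 71 / Q) ≤ δ) (hQ : 0 < Q) (hM : Q ≤ M)
    {v : Fin n} (hv : v ∉ S) :
    Approximates G δ (Insert.insert v S) (M * approx L.neighbors Q k S v / Q) F := by
  refine h.insert hdeg hδ hv
    ((abs_cast_mul_div_sub_le hQ hM (abs_approx_sub_ratio_le hdeg L hQ k hv)).trans ?_)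
  have hr := three_quarters_le_ratio hdeg hv
  have hη : (15 / 16) ^ k + 70 / Q + 1 / Q ≤ δ * G.ratio S v := by
    have hδ0 : 0 ≤ δ := le_trans (by positivity) hk
    calc (15 / 16) ^ k + 70 / Q + 1 / Q = (15 / 16) ^ k + 71 / (Q : ℝ) := by ring
      _ ≤ δ * (3 / 4) := by linarith
      _ ≤ δ * G.ratio S v := by gcongr
  calc (M : ℝ) * ((15 / 16) ^ k + 70 / Q + 1 / Q) ≤ M * (δ * G.ratio S v) := by gcongr
    _ = δ * (M * G.ratio S v) := by ring

theorem le_two_mul_mul_approx_div (hdeg : ∀ v, 3 ≤ G.degree v) (hM : Q ≤ M) {v : Fin n}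
    (hv : v ∉ S) : Q ≤ M * approx L.neighbors Q k S v / Q + M * approx L.neighbors Q k S v / Q := by
  rcases Nat.eq_zero_or_pos Q with rfl | hQ
  · exact Nat.zero_le _
  have hdiv : approx L.neighbors Q k S v ≤ M * approx L.neighbors Q k S v / Q := by
    rw [Nat.le_div_iff_mul_le hQ, mul_comm]
    exact Nat.mul_le_mul_right _ hM
  have hx := three_quarters_le_approx hdeg L Q k hv
  have hQx : (Q : ℝ) ≤ (2 * approx L.neighbors Q k S v : ℕ) := by
    rw [Nat.cast_mul, Nat.cast_two]
    linarith [Nat.cast_nonneg (α := ℝ) Q]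
  have := Nat.cast_le.1 hQx
  omega

end MultiGraph

namespace RAM

open MultiGraph Set

theorem StoresSet.insert {n a : ℕ} {μ : ℕ → ℕ} {S : Finset (Fin n)} (h : StoresSet μ a S)
    (v : Fin n) : StoresSet (Function.update μ (a + v) 1) a (insert v S) := by
  intro w
  rcases eq_or_ne w v with rfl | hw
  · simp
  · have hw' : a + w.val ≠ a + v := by simpa [Fin.val_inj] using hw
    rw [Function.update_of_ne hw', h w]
    simp only [Finset.mem_insert, hw, false_or]

/-- The program has stopped with an approximation of the number of sink-free orientations. -/
def Success {n m : ℕ} (G : MultiGraph n m) (δ : ℝ) (c : Config) : Prop :=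
  Halted counter c ∧ c.reg 1 = m ∧ Approximates G δ Finset.univ (c.reg 0) (c.reg 2)

section

variable {B n m Q K M F base j T v' k y ptr limit u t s : ℕ} {G : MultiGraph n m} {L : G.AdjList}
  {δ : ℝ} {Post : Config → Prop} {inp μ : ℕ → ℕ}

theorem reaches_of_accumulate (hdeg : ∀ v, 3 ≤ G.degree v) (hδ : |δ| ≤ 1)
    (hK : 4 / 3 * ((15 / 16) ^ K + 71 / Q) ≤ δ) (hQ : 0 < Q) (hQB : 2 * Q * Q < B)
    (hFB : F + 1 < B) {S : Finset (Fin n)} {v : Fin n} (hv : v ∉ S) (hM : Q ≤ M) (hM' : M < 2 * Q)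
    (hacc : Approximates G δ S M F)
    (h : ∀ M' F' x, F' ≤ F + 1 → Q ≤ M' → M' < 2 * Q → Approximates G δ (insert v S) M' F' →
      Reaches counter B Post T
        ⟨34, regs (Env.file ⟨M', m, F', n, Q, base, K, j⟩ base v' k y ptr limit u t s x), μ⟩) :
    Reaches counter B Post (T + 5) ⟨Label.accumulate, regs (Env.file ⟨M, m, F, n, Q, base, K, j⟩
      base v' k y ptr limit u t s (approx L.neighbors Q K S v)), μ⟩ := by
  have hacc' := hacc.mul_approx (L := L) (k := K) hdeg hδ hK hQ hM hv
  have hhalf := le_two_mul_mul_approx_div (L := L) (k := K) hdeg hM hv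
  have hx := approx_le L.neighbors Q K S v
  generalize approx L.neighbors Q K S v = x at *
  have hMx : M * x ≤ M * Q := Nat.mul_le_mul_left _ hx
  have hMxB : M * x < B := (hMx.trans (Nat.mul_le_mul_right _ hM'.le)).trans_lt hQB
  have hdiv : M * x / Q ≤ M := Nat.div_le_of_le_mul (by rwa [mul_comm Q])
  have hQ2 : 2 * Q ≤ 2 * Q * Q := Nat.le_mul_of_pos_right _ hQ
  refine .mul rfl hMxB (.div rfl ?_)
  change Reaches _ _ _ _ ⟨_, regs (Env.file ⟨M * x / Q, m, F, n, Q, base, K, j⟩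
    _ _ _ _ _ _ _ _ _ _), _⟩
  rcases lt_or_ge (M * x / Q) Q with hlt | hge
  · exact .jlt rfl hlt (.add rfl (show M * x / Q + M * x / Q < B by omega)
      (.add rfl hFB (h (M * x / Q + M * x / Q) _ _ le_rfl hhalf (by omega) hacc'.double)))
  · exact .mono (T := T + 2)
      (.jge rfl hge (.jump rfl (h (M * x / Q) _ _ (Nat.le_succ F) hge (by omega) hacc'))) (by omega)

theorem reaches_of_vertexLoop (hdeg : ∀ v, 3 ≤ G.degree v) (hinp : Holds L base inp) (hδ : |δ| ≤ 1)
    (hK : 4 / 3 * ((15 / 16) ^ K + 71 / Q) ≤ δ) (hQ : 0 < Q) (hQB : 2 * Q * Q < B)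
    (hB : base + (K + 3) * (n + 5) < B) {r : ℕ} (hj : j + r = n) (hF : F + r < B) {x : ℕ}
    (hM : Q ≤ M) (hM' : M < 2 * Q) (hacc : Approximates G δ (below n j) M F)
    (hμ : EqOn μ inp (Iio base)) (hS : StoresSet μ base (below n j)) :
    Reaches counter B (Success G δ) (r * ((7 * n + 40) * 4 ^ K + 7 * n + 20) + 1)
      ⟨Label.vertexLoop, regs (Env.file ⟨M, m, F, n, Q, base, K, j⟩ base v' k y ptr limit u t s x),
        μ⟩ := by
  have hle : 3 * (n + 5) ≤ (K + 3) * (n + 5) := Nat.mul_le_mul_right _ (by omega)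
  induction r generalizing j M F v' k y ptr limit u t s x μ with
  | zero =>
    obtain rfl : j = n := hj
    have huniv : below j j = Finset.univ := by ext w; simp [mem_below]
    exact .mono (T := 0 + 1) (.jge rfl le_rfl (.done ⟨rfl, rfl, huniv ▸ hacc⟩)) (by omega)
  | succ r ih =>
    have hjn : j < n := by omega
    have hnotMem : (⟨j, hjn⟩ : Fin n) ∉ below n j := by simp [mem_below]
    have hinsert : insert ⟨j, hjn⟩ (below n j) = below n (j + 1) := insert_below ⟨j, hjn⟩
    have hQB' : Q * Q < B := (Nat.mul_le_mul_right _ (by omega)).trans_lt hQB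
    refine .mono (T := r * ((7 * n + 40) * 4 ^ K + 7 * n + 20) + 1 + 3 + 5 + 3 +
      (7 * n + 40) * 4 ^ K + 2 + 7 * n + 2 + 1 + 3) ?_ (by rw [Nat.succ_mul r]; omega)
    refine .jlt rfl hjn (.copy rfl rfl (.copy rfl rfl ?_))
    refine (evaluates (E := ⟨M, m, F, n, Q, base, K, j⟩) hdeg hinp hQB'
      (show base < B by omega) K).call hnotMem le_rfl hB ⟨hμ, hS⟩
      fun μ' v' k' y' ptr' limit' u' t' s' (hlow : EqOn μ' μ (Iio (base + (n + 5)))) => ?_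
    refine .sub rfl ?_
    change Reaches _ _ _ _ ⟨_, regs (Env.file _ (base + (n + 5) - (n + 5)) _ _ _ _ _ _ _ _ _), _⟩
    rw [Nat.add_sub_cancel]
    refine .jge rfl le_rfl (.jump rfl (reaches_of_accumulate hdeg hδ hK hQ hQB (by omega) hnotMem
      hM hM' hacc fun M' F' x hF' hM hM' hacc' => ?_))
    rw [hinsert] at hacc'
    refine .add rfl (by simp; omega) (.store rfl (.add rfl (by simp; omega)
      (ih (by omega) (by omega) hM hM' hacc' (fun a ha => ?_) ?_)))
    · rw [mem_Iio] at ha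
      exact (Function.update_of_ne (by simp; omega) _ _).trans
        ((hlow (by simp only [mem_Iio]; omega)).trans (hμ ha))
    · exact hinsert ▸ (hS.congr hlow (by omega)).insert ⟨j, hjn⟩

end

end RAM

/-! ### The parameters of the program -/

namespace RAM

/-- The precision `N` of the program on the input `n, m, a, b`: it makes the relative error at each
vertex at most `1 / (2 * N)`. The factor `n + 5` instead of `n` keeps `N` positive, and the program
has it at hand as the size of a stack frame. -/
def precision (n a b : ℕ) : ℕ := (b / a + 1) * (n + 5)

/-- The scale of the fixed-point numbers, for precision `N`. -/
def fixedScale (N : ℕ) : ℕ := 4096 * 2 ^ Nat.clog 2 N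

/-- The budget of the outermost recursive calls, for precision `N`. The constants are due to
`(15 / 16) ^ 44 ≤ 1 / 16` and `(15 / 16) ^ 11 ≤ 1 / 2`. -/
def initialBudget (N : ℕ) : ℕ := 44 + 11 * Nat.clog 2 N

section

variable {B n m a b N base T : ℕ} {Post : Config → Prop} {μ : ℕ → ℕ}

theorem reaches_of_scaleLoop (hscale : 2 * fixedScale N < B) (hbudget : initialBudget N < B)
    (h : ∀ t s, Reaches counter B Post T ⟨26, regs (Env.file ⟨0, m, 12 + Nat.clog 2 N, n,
      fixedScale N, base, initialBudget N, 0⟩ base 0 0 0 0 0 0 t s 0), μ⟩)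
    {r j : ℕ} (hj : j + r = Nat.clog 2 N) :
    Reaches counter B Post (T + 5 * r + 2) ⟨Label.scaleLoop, regs (Env.file ⟨0, m, 12 + j, n,
      4096 * 2 ^ j, base, 44 + 11 * j, 0⟩ base 0 0 0 0 0 0 (N * 4096) 11 0), μ⟩ := by
  rw [fixedScale] at hscale
  rw [initialBudget] at hbudget
  induction r generalizing j with
  | zero =>
    obtain rfl : j = Nat.clog 2 N := hj
    have hN := Nat.le_pow_clog one_lt_two N
    exact .jge rfl (show N * 4096 ≤ 4096 * 2 ^ Nat.clog 2 N by omega) (.jump rfl (h _ _))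
  | succ r ih =>
    have hlt : 2 ^ j < N := Nat.pow_lt_of_lt_clog (by omega)
    have hle : 2 ^ j ≤ 2 ^ Nat.clog 2 N := Nat.pow_le_pow_right two_pos (by omega)
    have hdouble : 4096 * 2 ^ j + 4096 * 2 ^ j = 4096 * 2 ^ (j + 1) := by ring
    refine .jlt rfl (show 4096 * 2 ^ j < N * 4096 by omega)
      (.add rfl (show 4096 * 2 ^ j + 4096 * 2 ^ j < B by omega)
      (.add rfl (show 12 + j + 1 < B by omega)
      (.add rfl (show 44 + 11 * j + 11 < B by omega) (.jump rfl ?_))))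
    change Reaches _ _ _ _ ⟨_, regs (Env.file ⟨0, m, 12 + (j + 1), n, 4096 * 2 ^ j + 4096 * 2 ^ j,
      base, 44 + 11 * (j + 1), 0⟩ base 0 0 0 0 0 0 (N * 4096) 11 0), _⟩
    rw [hdouble]
    exact ih (by omega)

theorem init_eq (input : List ℕ) :
    init input = ⟨0, regs (List.replicate 21 0), fun i => input.getD i 0⟩ := by
  have hregs : regs (List.replicate 21 0) = fun _ => 0 := by
    funext i
    rw [regs, List.getD, List.getElem?_replicate]
    split_ifs <;> rfl
  rw [hregs, init]

open MultiGraph in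
theorem reaches_of_start {G : MultiGraph n m} (L : G.AdjList)
    (hscale : 2 * fixedScale (precision n a b) < B) (hbudget : initialBudget (precision n a b) < B)
    (hN : precision n a b * 4096 < B)
    (h : ∀ t s, Reaches counter B Post T ⟨Label.vertexLoop, regs (Env.file
      ⟨fixedScale (precision n a b), m, 12 + Nat.clog 2 (precision n a b), n,
        fixedScale (precision n a b), L.offset n, initialBudget (precision n a b), 0⟩
      (L.offset n) 0 0 0 0 0 0 t s 0), L.memory a b⟩) :
    Reaches counter B Post (T + 5 * Nat.clog 2 (precision n a b) + 24) (init (L.encode a b)) := by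
  have hsize : n + 5 ≤ precision n a b := Nat.le_mul_of_pos_left _ (Nat.succ_pos _)
  have hdiv : b / a + 1 ≤ precision n a b := Nat.le_mul_of_pos_right _ (Nat.succ_pos _)
  have hbase : L.memory a b (n + 5 - 1) = L.offset n := by
    rw [show n + 5 - 1 = 4 + n by omega, L.memory_offset a b le_rfl]
  rw [init_eq]
  change Reaches _ _ _ _
    ⟨0, regs [0, 0, 0, 0, 0, 0, 0, 0, 0, 0, 0, 0, 0, 0, 0, 0, 0, 0, 0, 0, 0], _⟩
  refine .mono (T := T + 2 + 5 * Nat.clog 2 (precision n a b) + 2 + 20) ?_ (by omega)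
  refine .load (z := n) rfl rfl (.const rfl (by omega) (.load (z := m) rfl rfl
    (.const rfl (by omega) (.const rfl (by omega) ?_))))
  change Reaches _ _ _ _
    ⟨5, regs [0, m, 0, n, 0, 0, 0, 0, 1, 2, 5, 0, 0, 0, 0, 0, 0, 0, 0, 0, 0], _⟩
  refine .add rfl (show n + 5 < B by omega) (.load (z := a) rfl rfl
    (.add rfl (show 1 + 2 < B by omega) (.load (z := b) rfl rfl (.div rfl ?_))))
  change Reaches _ _ _ _
    ⟨10, regs [0, m, 0, n, 0, 0, 0, 0, 1, 2, n + 5, 0, 0, 0, 0, 0, 0, 0, b / a, b, 0], _⟩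
  refine .add rfl (show b / a + 1 < B by omega) (.mul rfl
    (show precision n a b < B by omega) (.sub rfl (.load rfl hbase (.copy rfl rfl ?_))))
  change Reaches _ _ _ _ ⟨15, regs [0, m, 0, n, 0, L.offset n, 0, 0, 1, 2, n + 5, L.offset n,
    0, 0, 0, 0, 0, 0, precision n a b, b, 0], _⟩
  refine .const rfl (by omega) (.mul rfl hN (.const rfl (by omega) (.const rfl (by omega)
    (.const rfl (by omega) ?_))))
  exact reaches_of_scaleLoop (r := Nat.clog 2 (precision n a b)) hscale hbudget
    (fun t s => .copy rfl rfl (.jump rfl (h t s))) (j := 0) (zero_add _)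

end

end RAM

namespace RAM

/-! ### Accuracy, word size and running time -/

theorem precision_pos (n a b : ℕ) : 0 < precision n a b :=
  Nat.mul_pos (Nat.succ_pos _) (Nat.succ_pos _)

theorem two_pow_clog_le {N : ℕ} (hN : 0 < N) : 2 ^ Nat.clog 2 N ≤ 2 * N := by
  rcases Nat.lt_or_ge 1 N with h | h
  · obtain ⟨c, hc⟩ := Nat.exists_eq_succ_of_ne_zero (Nat.clog_pos one_lt_two h).ne'
    have hlt := Nat.pow_pred_clog_lt_self one_lt_two h
    rw [hc, Nat.pred_succ] at hlt
    rw [hc, pow_succ]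
    omega
  · rw [Nat.clog_of_right_le_one h]
    omega

theorem error_le_one_div {N : ℕ} (hN : 0 < N) :
    4 / 3 * ((15 / 16 : ℝ) ^ initialBudget N + 71 / fixedScale N) ≤ 1 / (2 * N) := by
  have hN' : (0 : ℝ) < N := mod_cast hN
  have hclog : (1 : ℝ) / 2 ^ Nat.clog 2 N ≤ 1 / N := by
    gcongr
    exact_mod_cast Nat.le_pow_clog one_lt_two N
  have htruncation : (15 / 16 : ℝ) ^ initialBudget N ≤ 1 / 16 * (1 / 2 ^ Nat.clog 2 N) := by
    rw [initialBudget, pow_add, pow_mul, ← one_div_pow]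
    gcongr <;> norm_num
  have hrounding : (71 : ℝ) / fixedScale N = 71 / 4096 * (1 / 2 ^ Nat.clog 2 N) := by
    rw [fixedScale, Nat.cast_mul, Nat.cast_pow]
    field_simp
    norm_num
  have hhalf : (1 : ℝ) / (2 * N) = 1 / 2 * (1 / N) := by field_simp
  rw [hrounding, hhalf]
  linarith [one_div_pos.2 hN']

theorem mul_pow_le_pow_add {c X k : ℕ} (hX : 3 ≤ X) (hc : c ≤ 3 ^ k) (j : ℕ) :
    c * X ^ j ≤ X ^ (k + j) := by
  rw [pow_add]
  exact Nat.mul_le_mul_right _ (hc.trans (Nat.pow_le_pow_left hX k))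

section

variable {n m a b : ℕ}

theorem two_pow_clog_precision_le (ha : 0 < a) (hab : a < b) :
    2 ^ Nat.clog 2 (precision n a b) ≤ (n + m + a + b) ^ 4 := by
  have hX : 3 ≤ n + m + a + b := by omega
  have hdiv : b / a ≤ b := Nat.div_le_self b a
  calc 2 ^ Nat.clog 2 (precision n a b) ≤ 2 * precision n a b :=
        two_pow_clog_le (precision_pos n a b)
    _ ≤ 2 * ((n + m + a + b) * (n + m + a + b) ^ 2) :=
        Nat.mul_le_mul_left 2 (Nat.mul_le_mul (by omega) (by nlinarith))
    _ ≤ (n + m + a + b) ^ 4 := by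
        rw [← pow_succ']
        exact mul_pow_le_pow_add (k := 1) hX (by norm_num) 3

theorem two_mul_fixedScale_sq_lt (ha : 0 < a) (hab : a < b) :
    2 * fixedScale (precision n a b) * fixedScale (precision n a b) < (n + m + a + b) ^ 30 := by
  have hX : 3 ≤ n + m + a + b := by omega
  have hpow := two_pow_clog_precision_le (n := n) (m := m) ha hab
  rw [fixedScale]
  generalize 2 ^ Nat.clog 2 (precision n a b) = p at hpow
  calc 2 * (4096 * p) * (4096 * p)
      ≤ 2 * (4096 * (n + m + a + b) ^ 4) * (4096 * (n + m + a + b) ^ 4) := by gcongr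
    _ = 33554432 * (n + m + a + b) ^ 8 := by ring
    _ ≤ (n + m + a + b) ^ (16 + 8) := mul_pow_le_pow_add hX (by norm_num) 8
    _ < (n + m + a + b) ^ 30 := Nat.pow_lt_pow_right (by omega) (by norm_num)

theorem memory_size_lt (ha : 0 < a) (hab : a < b) :
    n + 5 + 4 * m + (initialBudget (precision n a b) + 3) * (n + 5) < (n + m + a + b) ^ 30 := by
  have hX : 3 ≤ n + m + a + b := by omega
  have hpow := two_pow_clog_precision_le (n := n) (m := m) ha hab
  have hclog := Nat.lt_two_pow_self (n := Nat.clog 2 (precision n a b))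
  have hone : 1 ≤ (n + m + a + b) ^ 4 := Nat.one_le_pow _ _ (by omega)
  have hsize : n + 5 + 4 * m ≤ 5 * (n + m + a + b) := by omega
  have hframe : n + 5 ≤ 2 * (n + m + a + b) := by omega
  have hbudget : initialBudget (precision n a b) + 3 ≤ 58 * (n + m + a + b) ^ 4 := by
    rw [initialBudget]
    omega
  generalize n + m + a + b = X at *
  calc n + 5 + 4 * m + (initialBudget (precision n a b) + 3) * (n + 5)
      ≤ 5 * X + 58 * X ^ 4 * (2 * X) := add_le_add hsize (Nat.mul_le_mul hbudget hframe)
    _ ≤ 5 * X ^ 5 + 58 * X ^ 4 * (2 * X) := by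
        gcongr
        exact Nat.le_self_pow (by norm_num) X
    _ = 121 * X ^ 5 := by ring
    _ ≤ X ^ (5 + 5) := mul_pow_le_pow_add hX (by norm_num) 5
    _ < X ^ 30 := Nat.pow_lt_pow_right (by omega) (by norm_num)

end

theorem one_sub_le_pow_and_pow_le_one_add {n N : ℕ} {ε : ℝ} (hε : 0 < ε) (hε1 : ε < 1)
    (hN : 0 < N) (hNε : n / ε ≤ N) :
    1 - ε ≤ (1 - 1 / (2 * N : ℝ)) ^ n ∧ (1 + 1 / (2 * N : ℝ)) ^ n ≤ 1 + ε := by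
  have hN' : (1 : ℝ) ≤ N := mod_cast hN
  have hδ0 : (0 : ℝ) ≤ 1 / (2 * N) := by positivity
  have hδ1 : (1 : ℝ) / (2 * N) ≤ 1 / 2 := by
    rw [div_le_iff₀ (by linarith)]
    linarith
  have hnδ : n * (1 / (2 * N : ℝ)) ≤ ε / 2 := by
    rw [div_le_iff₀ hε] at hNε
    rw [mul_one_div, div_le_iff₀ (by linarith)]
    linarith
  generalize (1 : ℝ) / (2 * N) = δ at *
  have hlow : 1 - n * δ ≤ (1 - δ) ^ n := by
    have hbernoulli := one_add_mul_le_pow (a := -δ) (by linarith) n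
    rwa [← sub_eq_add_neg, mul_neg, ← sub_eq_add_neg] at hbernoulli
  refine ⟨by linarith, ?_⟩
  have hprod : (1 + δ) ^ n * (1 - δ) ^ n ≤ 1 := by
    rw [← mul_pow]
    exact pow_le_one₀ (mul_nonneg (by linarith) (by linarith)) (by linarith [mul_self_nonneg δ])
  have hup : (1 + δ) ^ n * (1 - ε / 2) ≤ 1 :=
    (mul_le_mul_of_nonneg_left (by linarith) (by positivity)).trans hprod
  have hε2 : 1 ≤ (1 + ε) * (1 - ε / 2) := by nlinarith
  exact le_of_mul_le_mul_right (hup.trans hε2) (by linarith)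

theorem four_pow_initialBudget (N : ℕ) :
    4 ^ initialBudget N = 4 ^ 44 * (2 ^ Nat.clog 2 N) ^ 22 := by
  rw [initialBudget, pow_add, show 4 = 2 ^ 2 from rfl, ← pow_mul, ← pow_mul, ← pow_mul]
  ring_nf

theorem steps_le {n N : ℕ} {R : ℝ} (hn : 1 ≤ n) (hR : 1 ≤ R) (hN : 0 < N) (hNR : N ≤ 12 * R) :
    ((n * ((7 * n + 40) * 4 ^ initialBudget N + 7 * n + 20) + 1 + 5 * Nat.clog 2 N + 24 : ℕ) : ℝ) ≤
      219 * (4 ^ 44 * 24 ^ 22) * (n ^ 2 * R ^ 22) := by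
  have hn' : (1 : ℝ) ≤ n := mod_cast hn
  have hpow : ((2 ^ Nat.clog 2 N : ℕ) : ℝ) ≤ 24 * R := by
    have h : ((2 ^ Nat.clog 2 N : ℕ) : ℝ) ≤ (2 * N : ℕ) := Nat.cast_le.2 (two_pow_clog_le hN)
    rw [Nat.cast_mul, Nat.cast_two] at h
    linarith
  have hclog : (Nat.clog 2 N : ℝ) ≤ 24 * R :=
    (Nat.cast_le.2 Nat.lt_two_pow_self.le).trans hpow
  obtain ⟨W, hW⟩ : ∃ W : ℝ, W = 4 ^ 44 * 24 ^ 22 * R ^ 22 := ⟨_, rfl⟩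
  have hbranch : ((4 ^ initialBudget N : ℕ) : ℝ) ≤ W := by
    calc ((4 ^ initialBudget N : ℕ) : ℝ) = 4 ^ 44 * ((2 ^ Nat.clog 2 N : ℕ) : ℝ) ^ 22 := by
          rw [four_pow_initialBudget, Nat.cast_mul, Nat.cast_pow, Nat.cast_pow _ 22, Nat.cast_ofNat]
      _ ≤ 4 ^ 44 * (24 * R) ^ 22 := by gcongr
      _ = W := by rw [hW, mul_pow, mul_assoc]
  have hRW : R ≤ W := by
    rw [hW]
    exact (le_self_pow₀ hR (by norm_num)).trans
      (le_mul_of_one_le_left (by positivity) (by norm_num))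
  have hWn : W ≤ n * W := le_mul_of_one_le_left (by linarith) hn'
  have hnW : (n : ℝ) ≤ n * W := le_mul_of_one_le_right (by linarith) (hR.trans hRW)
  have hWnn : n * W ≤ n * (n * W) := le_mul_of_one_le_left (by linarith) hn'
  push_cast at hbranch ⊢
  calc (n : ℝ) * ((7 * n + 40) * 4 ^ initialBudget N + 7 * n + 20) + 1 + 5 * Nat.clog 2 N + 24
      ≤ n * ((7 * n + 40) * W + 7 * n + 20) + 1 + 5 * (24 * R) + 24 := by gcongr
    _ ≤ n * (74 * (n * W)) + 145 * (n * (n * W)) :=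
        have hinner : (7 * n + 40) * W + 7 * n + 20 ≤ 74 * (n * W) := by linarith
        have houter := mul_le_mul_of_nonneg_left hinner (by linarith : (0 : ℝ) ≤ n)
        by linarith
    _ = 219 * (4 ^ 44 * 24 ^ 22) * (n ^ 2 * R ^ 22) := by rw [hW]; ring

end RAM

namespace RAM

open MultiGraph

variable {n m a b B : ℕ} {G : MultiGraph n m} {ε : ℝ}

theorem approximates_empty (G : MultiGraph n m) (N : ℕ) (δ : ℝ) :
    Approximates G δ (below n 0) (fixedScale N) (12 + Nat.clog 2 N) := by
  have hbelow : below n 0 = ∅ := by simp [below]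
  have hvalue : ((fixedScale N : ℕ) : ℝ) * 2 ^ m / 2 ^ (12 + Nat.clog 2 N) = 2 ^ m := by
    rw [fixedScale, Nat.cast_mul, Nat.cast_pow, pow_add]
    norm_num
  rw [Approximates, hbelow, hvalue, G.avoid_empty]
  simp

theorem reaches_success (hdeg : ∀ v, 3 ≤ G.degree v) (L : G.AdjList)
    (hQB : 2 * fixedScale (precision n a b) * fixedScale (precision n a b) < B)
    (hB : n + 5 + 4 * m + (initialBudget (precision n a b) + 3) * (n + 5) < B) :
    Reaches counter B (Success G (1 / (2 * precision n a b)))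
      (n * ((7 * n + 40) * 4 ^ initialBudget (precision n a b) + 7 * n + 20) + 1 +
        5 * Nat.clog 2 (precision n a b) + 24) (init (L.encode a b)) := by
  have hN := precision_pos n a b
  have hN' : (1 : ℝ) ≤ precision n a b := mod_cast hN
  have hδ : |(1 / (2 * precision n a b) : ℝ)| ≤ 1 := by
    rw [abs_of_nonneg (by positivity), div_le_one (by linarith)]
    linarith
  have hpow := Nat.le_pow_clog one_lt_two (precision n a b)
  have hscale : fixedScale (precision n a b) = 4096 * 2 ^ Nat.clog 2 (precision n a b) := rfl
  have hbudget : initialBudget (precision n a b) = 44 + 11 * Nat.clog 2 (precision n a b) := rfl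
  have hadd : initialBudget (precision n a b) + 3 + (n + 5) ≤
      (initialBudget (precision n a b) + 3) * (n + 5) := Nat.add_le_mul (by omega) (by omega)
  have hsq : 2 * fixedScale (precision n a b) ≤
      2 * fixedScale (precision n a b) * fixedScale (precision n a b) :=
    Nat.le_mul_of_pos_right _ (by omega)
  rw [← L.offset_order] at hB
  exact reaches_of_start L (by omega) (by omega) (by omega) fun t s =>
    reaches_of_vertexLoop hdeg (L.holds a b) hδ (error_le_one_div hN) (by omega) hQB hB
      (zero_add n) (by omega) le_rfl (by omega) (approximates_empty G _ _) (fun _ _ => rfl)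
      fun w => by rw [L.memory_of_le a b (by omega)]; simp [mem_below]

theorem exists_run_success (hdeg : ∀ v, 3 ≤ G.degree v) (L : G.AdjList) (ha : 0 < a)
    (hab : a < b) :
    ∃ t ≤ n * ((7 * n + 40) * 4 ^ initialBudget (precision n a b) + 7 * n + 20) + 1 +
        5 * Nat.clog 2 (precision n a b) + 24,
      Success G (1 / (2 * precision n a b)) (run counter (L.encode a b) t) ∧
      FitsInWords counter (L.encode a b) t ((n + m + a + b) ^ 30) := by
  have hsize := memory_size_lt (n := n) (m := m) ha hab
  have hX : n + m + a + b ≤ (n + m + a + b) ^ 30 := Nat.le_self_pow (by norm_num) _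
  exact reaches_success hdeg L (two_mul_fixedScale_sq_lt ha hab) hsize fun i =>
    ⟨(Nat.zero_le _).trans_lt hsize, L.memory_lt a b (by omega) (by omega)
      (by rw [L.offset_order]; omega) i⟩

theorem div_le_precision (ha : 0 < a) (hε : ε = a / b) : n / ε ≤ precision n a b := by
  have ha' : (0 : ℝ) < a := mod_cast ha
  have hlt : (b : ℝ) ≤ (b / a + 1 : ℕ) * a := by
    rw [mul_comm]
    exact_mod_cast (Nat.lt_mul_div_succ b ha).le
  calc n / ε = b / a * n := by rw [hε, div_div_eq_mul_div]; ring
    _ ≤ (b / a + 1 : ℕ) * (n + 5 : ℕ) := by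
        gcongr
        · rwa [div_le_iff₀ ha']
        · omega
    _ = precision n a b := by rw [precision, Nat.cast_mul]

theorem precision_le (hn : 1 ≤ n) (hε : ε = a / b) (hε0 : 0 < ε) (hε1 : ε < 1) :
    precision n a b ≤ 12 * (n / ε) := by
  have hn' : (1 : ℝ) ≤ n := mod_cast hn
  have hfloor : ((b / a : ℕ) : ℝ) ≤ 1 / ε := by
    rw [hε, one_div_div]
    exact Nat.cast_div_le
  have hinv : 1 ≤ 1 / ε := by
    rw [le_div_iff₀ hε0]
    linarith
  calc (precision n a b : ℝ) = ((b / a : ℕ) + 1) * (n + 5) := by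
        rw [precision, Nat.cast_mul, Nat.cast_add, Nat.cast_add, Nat.cast_one, Nat.cast_ofNat]
    _ ≤ (2 * (1 / ε)) * (6 * n) := by
        gcongr <;> linarith
    _ = 12 * (n / ε) := by ring

theorem Success.output_div_numSFO_mem_Icc {N : ℕ} {c : Config} (hdeg : ∀ v, 3 ≤ G.degree v)
    (hc : Success G (1 / (2 * N)) c) (hε0 : 0 < ε) (hε1 : ε < 1) (hN : 0 < N) (hNε : n / ε ≤ N) :
    c.output / G.numSFO ∈ Set.Icc (1 - ε) (1 + ε) := by
  obtain ⟨-, hm, hlower, hupper⟩ := hc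
  have hZ : (0 : ℝ) < G.numSFO := by
    rw [← G.avoid_univ]
    exact G.avoid_pos hdeg _
  rw [Finset.card_univ, Fintype.card_fin, G.avoid_univ] at hlower hupper
  obtain ⟨hε_lower, hε_upper⟩ := one_sub_le_pow_and_pow_le_one_add hε0 hε1 hN hNε
  rw [Set.mem_Icc, Config.output, hm, le_div_iff₀ hZ, div_le_iff₀ hZ]
  exact ⟨(mul_le_mul_of_nonneg_right hε_lower hZ.le).trans hlower,
    hupper.trans (mul_le_mul_of_nonneg_right hε_upper hZ.le)⟩

end RAM

theorem mul_pow_div_pow_le_mul_log (C : ℝ) {n : ℕ} {ε : ℝ} (hn : 2 ≤ n) (hε0 : 0 < ε)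
    (hε1 : ε < 1) :
    C * ((n : ℝ) ^ 24 / ε ^ 22) ≤
      |C| / Real.log 2 * ((n : ℝ) ^ 73 / ε ^ 72 * Real.log (n / ε)) := by
  have hn' : (2 : ℝ) ≤ n := mod_cast hn
  have hlog : 1 ≤ Real.log (n / ε) / Real.log 2 := by
    refine (one_le_div (Real.log_pos one_lt_two)).2 (Real.log_le_log two_pos ?_)
    rw [le_div_iff₀ hε0]
    linarith
  have hpow : (n : ℝ) ^ 24 / ε ^ 22 ≤ n ^ 73 / ε ^ 72 := by
    gcongr ?_ / ?_
    · exact pow_le_pow_right₀ (by linarith) (by norm_num)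
    · exact pow_le_pow_of_le_one hε0.le hε1.le (by norm_num)
  calc C * ((n : ℝ) ^ 24 / ε ^ 22) ≤ |C| * (n ^ 73 / ε ^ 72) := by gcongr; exact le_abs_self C
    _ ≤ |C| * (n ^ 73 / ε ^ 72) * (Real.log (n / ε) / Real.log 2) :=
        le_mul_of_one_le_right (by positivity) hlog
    _ = _ := by ring

theorem theorem1_general :
    ∃ (P : RAM.Program) (C : ℝ) (K : ℕ),
      ∀ (n m : ℕ) (G : MultiGraph n m) (L : G.AdjList) (a b : ℕ) (ε : ℝ),
        (∀ v, 3 ≤ G.degree v) → ε = (a : ℝ) / (b : ℝ) → 0 < ε → ε < 1 →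
        ∃ t : ℕ,
          RAM.Halted P (RAM.run P (L.encode a b) t) ∧
          RAM.FitsInWords P (L.encode a b) t ((n + m + a + b) ^ K) ∧
          1 - ε ≤ (RAM.run P (L.encode a b) t).output / (G.numSFO : ℝ) ∧
          (RAM.run P (L.encode a b) t).output / (G.numSFO : ℝ) ≤ 1 + ε ∧
          (1 ≤ n → (t : ℝ) ≤ C * ((n : ℝ) ^ 24 / ε ^ 22)) := by
  refine ⟨RAM.counter, 219 * (4 ^ 44 * 24 ^ 22), 30, fun n m G L a b ε hdeg hε hε0 hε1 => ?_⟩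
  have ha : 0 < a := Nat.pos_of_ne_zero fun h => by simp [hε, h] at hε0
  have hb : 0 < b := Nat.pos_of_ne_zero fun h => by simp [hε, h] at hε0
  have hab : a < b := by
    rwa [hε, div_lt_one (Nat.cast_pos.2 hb), Nat.cast_lt] at hε1
  have hN := RAM.precision_pos n a b
  obtain ⟨t, ht, hsuccess, hfits⟩ := RAM.exists_run_success hdeg L ha hab
  obtain ⟨hlower, hupper⟩ :=
    hsuccess.output_div_numSFO_mem_Icc hdeg hε0 hε1 hN (RAM.div_le_precision ha hε)
  refine ⟨t, hsuccess.1, hfits, hlower, hupper, fun hn => (Nat.cast_le.2 ht).trans ?_⟩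
  have hn' : (1 : ℝ) ≤ n := mod_cast hn
  have hR : 1 ≤ n / ε := (one_le_div hε0).2 (hε1.le.trans hn')
  calc _ ≤ 219 * (4 ^ 44 * 24 ^ 22) * ((n : ℝ) ^ 2 * (n / ε) ^ 22) :=
        RAM.steps_le hn hR hN (RAM.precision_le hn hε hε0 hε1)
    _ = _ := by rw [div_pow]; ring

theorem theorem1 :
    ∃ (P : RAM.Program) (C : ℝ) (K : ℕ),
      ∀ (n m : ℕ) (G : MultiGraph n m) (L : G.AdjList) (a b : ℕ) (ε : ℝ),
        (∀ v, 3 ≤ G.degree v) → ε = (a : ℝ) / (b : ℝ) → 0 < ε → ε < 1 →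
        ∃ t : ℕ,
          RAM.Halted P (RAM.run P (L.encode a b) t) ∧
          RAM.FitsInWords P (L.encode a b) t ((n + m + a + b) ^ K) ∧
          1 - ε ≤ (RAM.run P (L.encode a b) t).output / (G.numSFO : ℝ) ∧
          (RAM.run P (L.encode a b) t).output / (G.numSFO : ℝ) ≤ 1 + ε ∧
          (2 ≤ n → (t : ℝ) ≤ C * ((n : ℝ) ^ 73 / ε ^ 72 * Real.log ((n : ℝ) / ε))) := by
  obtain ⟨P, C, K, h⟩ := theorem1_general
  refine ⟨P, |C| / Real.log 2, K, fun n m G L a b ε hdeg hε hε0 hε1 => ?_⟩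
  obtain ⟨t, hhalt, hfits, hlower, hupper, htime⟩ := h n m G L a b ε hdeg hε hε0 hε1
  exact ⟨t, hhalt, hfits, hlower, hupper, fun hn =>
    (htime (one_le_two.trans hn)).trans (mul_pow_div_pow_le_mul_log C hn hε0 hε1)⟩
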